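/- Let $D$ be a finite set, $r\ge 1$ an integer and $R\subseteq D^r$ a predicate, with complement $\overline R:=D^r\setminus R$. An instance of $\operatorname{CSP}(R)$ on $n$ variables is a pair $\Psi=(X,Y)$ with $|X|=n$ and $Y\subseteq X^r$. An assignment $\sigma:X\to D$ satisfies the clause $y=(y_1,\dots,y_r)\in Y$ if $\sigma(y):=(\sigma(y_1),\dots,\sigma(y_r))\in R$, and $\operatorname{sat}(R,\Psi)$ is the set of assignments that satisfy all clauses of $\Psi$. For $w:Y\to\mathbb R_{\ge 0}$ put $\operatorname{wt}(R,\Psi,w,\sigma):=\sum_{y\in Y}w(y)\,\mathbf 1[\sigma(y)\in R]$. Given clause weights $w:Y\to\mathbb R_{>0}$ and $\varepsilon\in(0,1)$, a $(w,\varepsilon)$-sparsifier of $\Psi$ is a function $\widetilde w:Y\to\mathbb R_{\ge 0}$ such that $$(1-\varepsilon)\operatorname{wt}(R,\Psi,w,\sigma)\le \operatorname{wt}(R,\Psi,\widetilde w,\sigma)\le(1+\varepsilon)\operatorname{wt}(R,\Psi,w,\sigma)\quad\text{for all }\sigma:X\to D.$$ The $\varepsilon$-sparsity of $(\Psi,w)$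 is the minimum support size $|\{y\in Y:\widetilde w(y)\neq 0\}|$ of a $(w,\varepsilon)$-sparsifier $\widetilde w$ of $\Psi$, and the weighted sparsity $\operatorname{wSPR}(R,n,\varepsilon)$ is the maximum $\varepsilon$-sparsity of $(\Psi,w)$ over all instances $\Psi$ of $\operatorname{CSP}(R)$ on $n$ variables and all weights $w:Y\to\mathbb R_{>0}$. For a predicate $P\subseteq D^r$, the chain length $\operatorname{CL}(P,n)$ is the maximum $\ell$ for which there are instances $\Psi_1,\dots,\Psi_\ell$ of $\operatorname{CSP}(P)$ on a common set of $n$ variables with $\operatorname{sat}(P,\Psi_1)\subsetneq\operatorname{sat}(P,\Psi_2)\subsetneq\cdots\subsetneq\operatorname{sat}(P,\Psi_\ell)$. **Theorem.** There is an absolute constant $C>0$ such that for every finite set $D$, every integer $r\ge1$, every $R\subseteq D^r$, every integer $n\ge 1$ and every $\varepsilon\in(0,1)$, $$\operatorname{CL}(\overline R,n)-1\le\operatorname{wSPR}(R,n,\varepsilon),$$ and, if $n\ge2$, $$\operatorname{wSPR}(R,n,\varepsilon)\le C\cdot\frac{\operatorname{CL}(\overline R,n)\,(r\log n)^6}{\varepsilon^2}.$$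 -/

import Mathlib

namespace WeightedCSP

/-- An instance of `CSP(R)` on the variable set `X`, for a predicate `R ⊆ D^r`: a set of clauses
`Y ⊆ X^r` (variables may repeat inside a clause). -/
abbrev CSPInstance (X : Type*) (r : ℕ) : Type _ := Finset (Fin r → X)

/-- `sat(R, Y)`: the assignments `σ : X → D` that satisfy every clause, i.e.
`(σ(y₁), …, σ(y_r)) ∈ R` for every `y ∈ Y`. -/
def sat {D X : Type*} {r : ℕ} (R : Set (Fin r → D)) (Y : CSPInstance X r) : Set (X → D) :=
  {σ | ∀ y ∈ Y, (fun i => σ (y i)) ∈ R}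

open Classical in
/-- The `(R, w)`-weight of the assignment `σ`: the total weight of the clauses it satisfies. -/
noncomputable def wt {D X : Type*} {r : ℕ} (R : Set (Fin r → D)) (Y : CSPInstance X r)
    (w : Y → ℝ) (σ : X → D) : ℝ :=
  ∑ y : Y, w y * (if (fun i => σ (y.1 i)) ∈ R then 1 else 0)

/-- `w'` is a `(w, ε)`-sparsifier of the instance `Y` of `CSP(R)`. -/
def IsSparsifier {D X : Type*} {r : ℕ} (R : Set (Fin r → D)) (Y : CSPInstance X r)
    (w : Y → ℝ) (ε : ℝ) (w' : Y → ℝ) : Prop :=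
  (∀ y, 0 ≤ w' y) ∧
    ∀ σ : X → D, (1 - ε) * wt R Y w σ ≤ wt R Y w' σ ∧ wt R Y w' σ ≤ (1 + ε) * wt R Y w σ

/-- The `ε`-sparsity of the weighted instance `(Y, w)`: the minimum support size of a
`(w, ε)`-sparsifier. -/
noncomputable def sparsity {D X : Type*} {r : ℕ} (R : Set (Fin r → D)) (Y : CSPInstance X r)
    (w : Y → ℝ) (ε : ℝ) : ℕ :=
  sInf {k | ∃ w' : Y → ℝ, IsSparsifier R Y w ε w' ∧ (Function.support w').ncard = k}

/-- `wSPR(R, n, ε)`: the maximum `ε`-sparsity of an instance of `CSP(R)` on `n` variables with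
positive clause weights. -/
noncomputable def wSPR {D : Type*} {r : ℕ} (R : Set (Fin r → D)) (n : ℕ) (ε : ℝ) : ℕ :=
  sSup {k | ∃ (Y : CSPInstance (Fin n) r) (w : Y → ℝ), (∀ y, 0 < w y) ∧ sparsity R Y w ε = k}

/-- `CL(R, n)`: the maximum length `ℓ` of a chain
`sat(R, Ψ₁) ⊊ sat(R, Ψ₂) ⊊ ⋯ ⊊ sat(R, Ψ_ℓ)` of instances of `CSP(R)` on `n` variables. -/
noncomputable def chainLength {D : Type*} {r : ℕ} (R : Set (Fin r → D)) (n : ℕ) : ℕ :=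
  sSup {ℓ | ∃ Ψ : Fin ℓ → CSPInstance (Fin n) r, StrictMono fun i => sat R (Ψ i)}

theorem wt_nonneg {D X : Type*} {r : ℕ} (R : Set (Fin r → D)) (Y : CSPInstance X r)
    (w : Y → ℝ) (hw : ∀ y, 0 ≤ w y) (σ : X → D) : 0 ≤ wt R Y w σ := by
  unfold wt
  refine Finset.sum_nonneg fun y _ => mul_nonneg (hw y) ?_
  split_ifs <;> norm_num

theorem isSparsifier_self {D X : Type*} {r : ℕ} (R : Set (Fin r → D)) (Y : CSPInstance X r)
    (w : Y → ℝ) (hw : ∀ y, 0 ≤ w y) (ε : ℝ) (hε : 0 ≤ ε) : IsSparsifier R Y w ε w := by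
  refine ⟨hw, fun σ => ?_⟩
  have h := mul_nonneg hε (wt_nonneg R Y w hw σ)
  constructor <;> nlinarith

/-- The minimum in the definition of `sparsity` is attained. -/
theorem sparsity_isLeast {D X : Type*} {r : ℕ} (R : Set (Fin r → D)) (Y : CSPInstance X r)
    (w : Y → ℝ) (hw : ∀ y, 0 ≤ w y) (ε : ℝ) (hε : 0 ≤ ε) :
    IsLeast {k | ∃ w' : Y → ℝ, IsSparsifier R Y w ε w' ∧ (Function.support w').ncard = k}
      (sparsity R Y w ε) :=
  ⟨Nat.sInf_mem ⟨_, w, isSparsifier_self R Y w hw ε hε, rfl⟩, fun _ hk => Nat.sInf_le hk⟩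

/-- The maximum in the definition of `wSPR` is attained. -/
theorem wSPR_isGreatest {D : Type*} {r : ℕ} (R : Set (Fin r → D)) (n : ℕ) (ε : ℝ) (hε : 0 ≤ ε) :
    IsGreatest {k | ∃ (Y : CSPInstance (Fin n) r) (w : Y → ℝ),
      (∀ y, 0 < w y) ∧ sparsity R Y w ε = k} (wSPR R n ε) := by
  have hb : BddAbove {k | ∃ (Y : CSPInstance (Fin n) r) (w : Y → ℝ),
      (∀ y, 0 < w y) ∧ sparsity R Y w ε = k} := by
    refine ⟨Fintype.card (Fin r → Fin n), ?_⟩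
    rintro k ⟨Y, w, hw, rfl⟩
    calc sparsity R Y w ε ≤ (Function.support w).ncard :=
          (sparsity_isLeast R Y w (fun y => (hw y).le) ε hε).2
            ⟨w, isSparsifier_self R Y w (fun y => (hw y).le) ε hε, rfl⟩
      _ ≤ Nat.card Y := Set.ncard_le_card _
      _ ≤ Fintype.card (Fin r → Fin n) := by
          rw [Nat.card_eq_fintype_card, Fintype.card_coe]
          exact Finset.card_le_univ _
  exact ⟨Nat.sSup_mem ⟨_, ∅, fun _ => 1, fun _ => one_pos, rfl⟩ hb, fun _ hk => le_csSup hb hk⟩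

/-- The maximum in the definition of `chainLength` is attained. -/
theorem chainLength_isGreatest {D : Type*} {r : ℕ} (R : Set (Fin r → D)) (n : ℕ) :
    IsGreatest {ℓ | ∃ Ψ : Fin ℓ → CSPInstance (Fin n) r, StrictMono fun i => sat R (Ψ i)}
      (chainLength R n) := by
  have hb : BddAbove
      {ℓ | ∃ Ψ : Fin ℓ → CSPInstance (Fin n) r, StrictMono fun i => sat R (Ψ i)} := by
    refine ⟨Fintype.card (CSPInstance (Fin n) r), ?_⟩
    rintro ℓ ⟨Ψ, hΨ⟩
    have hinj : Function.Injective Ψ := Function.Injective.of_comp (f := sat R) hΨ.injective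
    simpa using Fintype.card_le_of_injective Ψ hinj
  exact ⟨Nat.sSup_mem ⟨0, Fin.elim0, fun i => i.elim0⟩ hb, fun _ hk => le_csSup hb hk⟩

end WeightedCSP

/-! Both bounds pass through triangular lists. In a chain for the complement of `R`, each strict
inclusion yields a clause and an assignment, and these form a triangular sequence shorter by one.
Conversely, the suffixes of a triangular list of clauses form a chain.

Lower bound: put geometrically growing weights on a triangular sequence. The `i`-th assignment
satisfies clause `i` and otherwise only much lighter clauses, so no sparsifier can drop clause `i`
(`le_wSPR_of_triangular`).

Upper bound: this is cut sparsification in the style of Karger and Benczúr, for the family `F` of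
clause sets satisfied by assignments, with `rank F` in the role of the rank of a graph. Suppose that
all unions of subfamilies are heavy relative to rank (`Dense` with parameter `k`). Discarding the
sets that contain a random element, drawn proportionally to weight, lowers the rank, while a light
set is likely to survive. Hence there are few light sets (`Dense.sum_exp_le`), and a Chernoff and
union bound lets elements be sampled at rate `w y * A / k`, with `A` of order `log m / δ ^ 2`, `m`
bounding the number of elements.

For a general family, `Dense.exists_puncture` splits off a group of weight at most `2 * k * rank H`
and leaves a family that is dense at `2 * k`. Ranks add up along this splitting
(`rank_add_rank_le`), so all dyadic levels together keep `O(A * rank F)` elements. The spread of the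
weights does not matter: for a given set the low levels contribute a geometric sum, the high levels
nothing, and about `log (m / δ)` levels remain (`levelError_le`). With `δ` of order `ε / log (n ^
r)` this costs a cubed logarithm over `ε ^ 2`, which is stronger than the sixth power required. -/

/-! ### Triangular lists and the chain length of a set family -/

namespace SetFamily

variable {α : Type*}

/-- A list `y₁, …, y_ℓ` is triangular for `F` if there are `S₁, …, S_ℓ ∈ F` with `y_i ∈ S_i` and
`y_j ∉ S_i` for `j > i`. -/
def Triangular (F : Finset (Finset α)) : List α → Prop
  | [] => True
  | y :: l => (∃ S ∈ F, y ∈ S ∧ ∀ z ∈ l, z ∉ S) ∧ Triangular F l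

theorem Triangular.mono {F H : Finset (Finset α)} (h : H ⊆ F) :
    ∀ {l : List α}, Triangular H l → Triangular F l
  | [], _ => trivial
  | _ :: _, ⟨⟨S, hS, hS'⟩, hl⟩ => ⟨⟨S, h hS, hS'⟩, hl.mono h⟩

theorem Triangular.nodup {F : Finset (Finset α)} :
    ∀ {l : List α}, Triangular F l → l.Nodup
  | [], _ => List.nodup_nil
  | _ :: _, ⟨⟨_, _, hz, hS⟩, hl⟩ => List.nodup_cons.2 ⟨fun h => hS _ h hz, hl.nodup⟩

variable [DecidableEq α]

/-- The union of a set family. -/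
def support (F : Finset (Finset α)) : Finset α := F.biUnion id

theorem mem_support {F : Finset (Finset α)} {y : α} : y ∈ support F ↔ ∃ S ∈ F, y ∈ S := by
  simp [support]

theorem subset_support {F : Finset (Finset α)} {S : Finset α} (hS : S ∈ F) : S ⊆ support F :=
  fun _ hy => mem_support.2 ⟨S, hS, hy⟩

theorem support_mono {F H : Finset (Finset α)} (h : H ⊆ F) : support H ⊆ support F :=
  Finset.biUnion_subset_biUnion_of_subset_left _ h

theorem Triangular.mem_support {F : Finset (Finset α)} :
    ∀ {l : List α}, Triangular F l → ∀ y ∈ l, y ∈ support F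
  | [], _, _, hy => by simp at hy
  | z :: l, ⟨⟨S, hS, hz, _⟩, hl⟩, y, hy => by
    rcases List.mem_cons.1 hy with rfl | hy
    · exact subset_support hS hz
    · exact hl.mem_support y hy

theorem Triangular.length_le {F : Finset (Finset α)} {l : List α} (hl : Triangular F l) :
    l.length ≤ (support F).card := by
  rw [← List.toFinset_card_of_nodup hl.nodup]
  exact Finset.card_le_card fun y hy => hl.mem_support y (List.mem_toFinset.1 hy)

/-- The maximum length of a triangular list. -/
noncomputable def rank (F : Finset (Finset α)) : ℕ :=
  sSup {k | ∃ l : List α, Triangular F l ∧ l.length = k}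

theorem rank_isGreatest (F : Finset (Finset α)) :
    IsGreatest {k | ∃ l : List α, Triangular F l ∧ l.length = k} (rank F) := by
  have hb : BddAbove {k | ∃ l : List α, Triangular F l ∧ l.length = k} :=
    ⟨(support F).card, by rintro k ⟨l, hl, rfl⟩; exact hl.length_le⟩
  exact ⟨Nat.sSup_mem ⟨0, [], trivial, rfl⟩ hb, fun _ hk => le_csSup hb hk⟩

theorem exists_triangular (F : Finset (Finset α)) :
    ∃ l : List α, Triangular F l ∧ l.length = rank F := (rank_isGreatest F).1

theorem Triangular.length_le_rank {F : Finset (Finset α)} {l : List α} (hl : Triangular F l) :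
    l.length ≤ rank F := (rank_isGreatest F).2 ⟨l, hl, rfl⟩

theorem rank_le_card_support (F : Finset (Finset α)) : rank F ≤ (support F).card := by
  obtain ⟨l, hl, h⟩ := exists_triangular F
  exact h ▸ hl.length_le

/-- Triangular lists of a family inside `V` and of a family punctured at `V` concatenate. -/
theorem Triangular.append {F H H' : Finset (Finset α)} {V : Finset α} (hH : H ⊆ F)
    (hV : ∀ S ∈ H, S ⊆ V) (hH' : ∀ S' ∈ H', ∃ S ∈ F, S \ V = S') {l' : List α}
    (hl' : Triangular H' l') : ∀ {l : List α}, Triangular H l → Triangular F (l ++ l')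
  | [], _ => by
    rw [List.nil_append]
    induction l' with
    | nil => trivial
    | cons y l ih =>
      obtain ⟨⟨S', hS', hy, hS⟩, hl⟩ := hl'
      obtain ⟨S, hSF, rfl⟩ := hH' S' hS'
      refine ⟨⟨S, hSF, (Finset.mem_sdiff.1 hy).1, fun z hz hzS => ?_⟩, ih hl⟩
      obtain ⟨T', hT', hzT⟩ := SetFamily.mem_support.1 (hl.mem_support z hz)
      obtain ⟨T, -, rfl⟩ := hH' T' hT'
      exact hS z hz (Finset.mem_sdiff.2 ⟨hzS, (Finset.mem_sdiff.1 hzT).2⟩)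
  | y :: l, ⟨⟨S, hS, hy, hz⟩, hl⟩ => by
    refine ⟨⟨S, hH hS, hy, fun z hz' => ?_⟩, Triangular.append hH hV hH' hl' hl⟩
    rcases List.mem_append.1 hz' with h | h
    · exact hz z h
    · obtain ⟨T', hT', hzT⟩ := SetFamily.mem_support.1 (hl'.mem_support z h)
      obtain ⟨T, -, rfl⟩ := hH' T' hT'
      exact fun hzS => (Finset.mem_sdiff.1 hzT).2 (hV S hS hzS)

/-- This superadditivity lets the sizes of the groups, each bounded by its own rank, sum to a
multiple of `rank F`. With `H = ∅` it says that puncturing does not raise the rank. -/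
theorem rank_add_rank_le {F H H' : Finset (Finset α)} {V : Finset α} (hH : H ⊆ F)
    (hV : ∀ S ∈ H, S ⊆ V) (hH' : ∀ S' ∈ H', ∃ S ∈ F, S \ V = S') :
    rank H + rank H' ≤ rank F := by
  obtain ⟨l, hl, h⟩ := exists_triangular H
  obtain ⟨l', hl', h'⟩ := exists_triangular H'
  have := (Triangular.append hH hV hH' hl' hl).length_le_rank
  rwa [List.length_append, h, h'] at this

/-- A triangular list of sets avoiding `y` can be extended by `y` at the end. This is the rank drop
behind the contraction argument. -/
theorem rank_filter_notMem_lt {F : Finset (Finset α)} {y : α} (hy : y ∈ support F) :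
    rank (F.filter (y ∉ ·)) < rank F := by
  obtain ⟨l, hl, h⟩ := exists_triangular (F.filter (y ∉ ·))
  have key : ∀ l : List α, Triangular (F.filter (y ∉ ·)) l → Triangular F (l ++ [y]) := by
    intro l
    induction l with
    | nil =>
      intro _
      obtain ⟨S, hS, hyS⟩ := mem_support.1 hy
      exact ⟨⟨S, hS, hyS, by simp⟩, trivial⟩
    | cons z l ih =>
      rintro ⟨⟨S, hS, hz, hS'⟩, hl⟩
      obtain ⟨hSF, hyS⟩ := Finset.mem_filter.1 hS
      refine ⟨⟨S, hSF, hz, fun x hx => ?_⟩, ih hl⟩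
      rcases List.mem_append.1 hx with h | h
      · exact hS' x h
      · rwa [List.mem_singleton.1 h]
  have := (key l hl).length_le_rank
  rw [List.length_append, h] at this
  exact this

theorem rank_pos {F : Finset (Finset α)} {S : Finset α} (hS : S ∈ F) (hne : S.Nonempty) :
    0 < rank F := by
  obtain ⟨y, hy⟩ := hne
  exact (Nat.zero_le _).trans_lt (rank_filter_notMem_lt (subset_support hS hy))

/-- A polynomial bound of Sauer type for families of bounded rank. -/
theorem card_le_pow_rank (Y : Finset α) :
    ∀ F : Finset (Finset α), support F ⊆ Y → F.card ≤ (Y.card + 1) ^ rank F := by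
  induction Y using Finset.induction_on with
  | empty =>
    intro F hF
    have : F ⊆ {∅} := fun S hS =>
      Finset.mem_singleton.2 (Finset.subset_empty.1 ((subset_support hS).trans hF))
    simpa using Finset.card_le_card this
  | insert y Y hy ih =>
    intro F hF
    rw [Finset.card_insert_of_notMem hy]
    -- Sets avoiding `y` have smaller rank; sets containing `y` are determined by their puncture at
    -- `y`, whose rank is no larger. With `c = Y.card` and `rank F = a + 1` the two counts add to
    -- `(c + 1) ^ a * (c + 2)`.
    by_cases hyF : y ∈ support F
    · have h1 : ((F.filter (y ∉ ·)).card) ≤ (Y.card + 1) ^ (rank F - 1) := by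
        refine (ih _ ?_).trans
          (Nat.pow_le_pow_right (by lia) (Nat.le_sub_one_of_lt (rank_filter_notMem_lt hyF)))
        intro z hz
        obtain ⟨S, hS, hzS⟩ := mem_support.1 hz
        obtain ⟨hSF, hyS⟩ := Finset.mem_filter.1 hS
        refine (Finset.mem_insert.1 (hF (subset_support hSF hzS))).resolve_left ?_
        rintro rfl
        exact hyS hzS
      have h2 : ((F.filter (y ∈ ·)).card) ≤ (Y.card + 1) ^ rank F := by
        have hinj : Set.InjOn (· \ ({y} : Finset α)) (F.filter (y ∈ ·) : Finset (Finset α)) := by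
          intro S hS T hT hST
          have hyS := (Finset.mem_filter.1 hS).2
          have hyT := (Finset.mem_filter.1 hT).2
          ext z
          by_cases hz : z = y
          · simp [hz, hyS, hyT]
          · have := Finset.ext_iff.1 hST z
            simpa [hz] using this
        rw [← Finset.card_image_of_injOn hinj]
        refine (ih _ ?_).trans (Nat.pow_le_pow_right (by lia) ?_)
        · intro z hz
          obtain ⟨S, hS, hzS⟩ := mem_support.1 hz
          obtain ⟨T, hT, rfl⟩ := Finset.mem_image.1 hS
          obtain ⟨hzT, hzy⟩ := Finset.mem_sdiff.1 hzS
          exact (Finset.mem_insert.1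
            (hF (subset_support (Finset.mem_filter.1 hT).1 hzT))).resolve_left
              (by simpa using hzy)
        · refine le_trans (Nat.le_add_left _ _) (rank_add_rank_le (H := ∅) (V := {y})
            (Finset.empty_subset _) (by simp) fun S' hS' => ?_)
          obtain ⟨T, hT, rfl⟩ := Finset.mem_image.1 hS'
          exact ⟨T, (Finset.mem_filter.1 hT).1, rfl⟩
      have hpos : 0 < rank F := (Nat.zero_le _).trans_lt (rank_filter_notMem_lt hyF)
      obtain ⟨a, ha⟩ : ∃ a, rank F = a + 1 := ⟨rank F - 1, by lia⟩
      rw [← Finset.card_filter_add_card_filter_not (p := (y ∈ ·))]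
      rw [ha] at h1 h2 ⊢
      simp only [Nat.add_sub_cancel] at h1
      have h3 : (Y.card + 1) ^ a ≤ (Y.card + 1 + 1) ^ a := Nat.pow_le_pow_left (by lia) a
      calc _ ≤ (Y.card + 1) ^ (a + 1) + (Y.card + 1) ^ a := Nat.add_le_add h2 h1
        _ = (Y.card + 1) ^ a * (Y.card + 1 + 1) := by ring
        _ ≤ (Y.card + 1 + 1) ^ a * (Y.card + 1 + 1) := Nat.mul_le_mul_right _ h3
        _ = _ := by ring
    · refine (ih F fun z hz => ?_).trans (Nat.pow_le_pow_left (by lia) _)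
      refine (Finset.mem_insert.1 (hF hz)).resolve_left ?_
      rintro rfl
      exact hyF hz

/-! ### The partition function of a family with large unions -/

/-- Every subfamily `H` has a union of weight at least `k * rank H`. -/
def Dense (F : Finset (Finset α)) (w : α → ℝ) (k : ℝ) : Prop :=
  ∀ H ⊆ F, k * rank H ≤ ∑ y ∈ support H, w y

theorem Dense.mono {F H : Finset (Finset α)} {w : α → ℝ} {k : ℝ} (hF : Dense F w k) (h : H ⊆ F) :
    Dense H w k := fun K hK => hF K (hK.trans h)

theorem Dense.le_sum {F : Finset (Finset α)} {w : α → ℝ} {k : ℝ} (hk : 0 ≤ k) (hF : Dense F w k)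
    {S : Finset α} (hS : S ∈ F) (hne : S.Nonempty) : k ≤ ∑ y ∈ S, w y := by
  have h := hF {S} (by simpa using hS)
  have h1 : support {S} = S := by simp [support]
  have h2 : (1 : ℝ) ≤ rank {S} := by
    exact_mod_cast rank_pos (Finset.mem_singleton_self S) hne
  rw [h1] at h
  nlinarith

theorem exp_neg_two_mul_le {t : ℝ} (h0 : 0 ≤ t) (h1 : t ≤ 1 / 2) :
    Real.exp (-(2 * t)) ≤ 1 - t := by
  rw [Real.exp_neg, inv_le_comm₀ (Real.exp_pos _) (by linarith)]
  refine le_trans ?_ (Real.add_one_le_exp (2 * t))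
  rw [inv_le_iff_one_le_mul₀ (by linarith)]
  nlinarith

/-- A weighted form of Karger's contraction argument. -/
theorem Dense.sum_exp_le {w : α → ℝ} (hw : ∀ y, 0 < w y) {k b : ℝ} (hk : 0 < k) (hb : 0 ≤ b)
    (Y : Finset α) (n : ℕ) :
    ∀ F : Finset (Finset α), support F ⊆ Y → Dense F w k → rank F ≤ n →
      ∑ S ∈ F.filter (·.Nonempty),
          Real.exp (-((b + 2 * (harmonic n : ℝ)) * ((∑ y ∈ S, w y) / k))) ≤
        ∑ j ∈ Finset.range n, ((Y.card + 1) * Real.exp (-(b / 2))) ^ (j + 1) := by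
  induction n with
  | zero =>
    intro F _ _ hr
    rw [Finset.filter_false_of_mem, Finset.sum_empty, Finset.range_zero, Finset.sum_empty]
    intro S hS hne
    have := rank_pos hS hne
    lia
  | succ n ih =>
    intro F hFY hF hr
    have hharm : (harmonic (n + 1) : ℝ) = harmonic n + 1 / (n + 1) := by
      rw [harmonic_succ]; push_cast; ring
    have hH0 : (0 : ℝ) ≤ harmonic n := by
      rcases Nat.eq_zero_or_pos n with rfl | h
      · simp
      · exact_mod_cast (harmonic_pos h.ne').le
    have hn1 : (0 : ℝ) < 1 / (n + 1) := by positivity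
    have hx0 : ∀ S : Finset α, 0 ≤ (∑ y ∈ S, w y) / k := fun S =>
      div_nonneg (Finset.sum_nonneg fun y _ => (hw y).le) hk.le
    have hq0 : 0 ≤ ((Y.card + 1) * Real.exp (-(b / 2))) ^ (n + 1) := by positivity
    rw [Finset.sum_range_succ]
    -- If the rank is smaller than allowed, the previous bound applies, since a larger harmonic
    -- number only shrinks the summands.
    rcases Nat.lt_or_ge (rank F) (n + 1) with hlt | hge
    · refine le_trans (Finset.sum_le_sum fun S _ => ?_)
        ((ih F hFY hF (by lia)).trans (le_add_of_nonneg_right hq0))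
      rw [Real.exp_le_exp, neg_le_neg_iff]
      exact mul_le_mul_of_nonneg_right (by rw [hharm]; linarith) (hx0 S)
    have hrank : rank F = n + 1 := le_antisymm hr hge
    set W := ∑ y ∈ support F, w y with hW
    have hWk : k * (n + 1) ≤ W := by
      have := hF F subset_rfl
      rw [hrank] at this
      exact_mod_cast this
    have hW0 : 0 < W := lt_of_lt_of_le (by positivity) hWk
    -- A set of weight at most `W / 2` pays for its survival probability `1 - x / W` with the new
    -- harmonic term, because `W ≥ k * (n + 1)`. A heavier set has `x / k ≥ (n + 1) / 2`, so its
    -- summand is at most the last term, and the Sauer-type count handles all such sets.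
    have hsmall : ∀ S ∈ F.filter (·.Nonempty),
        Real.exp (-((b + 2 * (harmonic (n + 1) : ℝ)) * ((∑ y ∈ S, w y) / k))) ≤
          (1 - (∑ y ∈ S, w y) / W) *
            Real.exp (-((b + 2 * (harmonic n : ℝ)) * ((∑ y ∈ S, w y) / k))) +
          Real.exp (-(b / 2)) ^ (n + 1) := by
      intro S hS
      set x := ∑ y ∈ S, w y with hx
      have hx' : 0 ≤ x := Finset.sum_nonneg fun y _ => (hw y).le
      have hxW : x ≤ W := Finset.sum_le_sum_of_subset_of_nonneg
        (subset_support (Finset.mem_filter.1 hS).1) fun y _ _ => (hw y).le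
      by_cases h2 : x / W ≤ 1 / 2
      · refine le_trans ?_ (le_add_of_nonneg_right (by positivity))
        refine le_trans ?_ (mul_le_mul_of_nonneg_right
          (exp_neg_two_mul_le (by positivity) h2) (Real.exp_pos _).le)
        rw [← Real.exp_add, Real.exp_le_exp, hharm]
        have : x / W ≤ 1 / (n + 1) * (x / k) := by
          rw [div_mul_div_comm, one_mul, mul_comm ((n : ℝ) + 1) k]
          exact div_le_div_of_nonneg_left hx' (by positivity) hWk
        linarith
      · refine le_trans ?_ (le_add_of_nonneg_left (mul_nonneg ?_ (Real.exp_pos _).le))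
        · rw [← Real.exp_nat_mul, Real.exp_le_exp]
          have h3 : ((n : ℝ) + 1) / 2 ≤ x / k := by
            rw [le_div_iff₀ hk]
            rw [not_le, lt_div_iff₀ hW0] at h2
            nlinarith
          have h4 : b * (((n : ℝ) + 1) / 2) ≤ b * (x / k) := mul_le_mul_of_nonneg_left h3 hb
          have h5 : 0 ≤ 2 * (harmonic (n + 1) : ℝ) * (x / k) :=
            mul_nonneg (by rw [hharm]; linarith) (by positivity)
          push_cast
          linarith
        · rw [sub_nonneg, div_le_one hW0]
          exact hxW
    refine (Finset.sum_le_sum hsmall).trans ?_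
    rw [Finset.sum_add_distrib]
    refine add_le_add ?_ ?_
    · set f : Finset α → ℝ := fun S =>
        Real.exp (-((b + 2 * (harmonic n : ℝ)) * ((∑ y ∈ S, w y) / k))) with hf
      set B := ∑ j ∈ Finset.range n, ((Y.card + 1) * Real.exp (-(b / 2))) ^ (j + 1) with hB
      -- The survival probability is written as the chance that a `w`-random element misses `S`.
      -- After exchanging sums, each element `y` leaves a family of smaller rank.
      have hexp : ∀ S ∈ F.filter (·.Nonempty), (1 - (∑ y ∈ S, w y) / W) * f S =
          ∑ y ∈ support F, w y / W * (if y ∉ S then f S else 0) := by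
        intro S hS
        have hsub := subset_support (Finset.mem_filter.1 hS).1
        have h1 : 1 - (∑ y ∈ S, w y) / W = (∑ y ∈ support F \ S, w y) / W := by
          rw [eq_div_iff hW0.ne', sub_mul, div_mul_cancel₀ _ hW0.ne', one_mul, hW,
            ← Finset.sum_sdiff hsub]
          ring
        rw [h1, Finset.sum_div, Finset.sum_mul]
        simp only [mul_ite, mul_zero]
        rw [← Finset.sum_filter, Finset.filter_notMem_eq_sdiff]
      rw [Finset.sum_congr rfl hexp, Finset.sum_comm]
      have hy : ∀ y ∈ support F,
          ∑ S ∈ F.filter (·.Nonempty), w y / W * (if y ∉ S then f S else 0) ≤ w y / W * B := by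
        intro y hy
        rw [← Finset.mul_sum, ← Finset.sum_filter, Finset.filter_filter]
        refine mul_le_mul_of_nonneg_left ?_ (div_nonneg (hw y).le hW0.le)
        have := ih (F.filter (y ∉ ·))
          ((support_mono (Finset.filter_subset _ _)).trans hFY)
          (hF.mono (Finset.filter_subset _ _))
          (by have := rank_filter_notMem_lt hy; lia)
        rw [Finset.filter_filter] at this
        simpa only [and_comm] using this
      refine (Finset.sum_le_sum hy).trans ?_
      rw [← Finset.sum_mul, ← Finset.sum_div, ← hW, div_self hW0.ne', one_mul]
    · rw [Finset.sum_const, nsmul_eq_mul, mul_pow]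
      refine mul_le_mul_of_nonneg_right ?_ (by positivity)
      have h1 : (F.filter (·.Nonempty)).card ≤ (Y.card + 1) ^ (n + 1) :=
        (Finset.card_filter_le _ _).trans (hrank ▸ card_le_pow_rank Y F hFY)
      exact_mod_cast h1

/-! ### Independent sampling -/

/-- The expectation of `Φ` on a random subset of `P` that contains `y` with probability `p y`,
independently. -/
noncomputable def expect (p : α → ℝ) (P : Finset α) (Φ : Finset α → ℝ) : ℝ :=
  ∑ T ∈ P.powerset, ((∏ y ∈ T, p y) * ∏ y ∈ P \ T, (1 - p y)) * Φ T

theorem expect_add (p : α → ℝ) (P : Finset α) (Φ Ψ : Finset α → ℝ) :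
    expect p P (fun T => Φ T + Ψ T) = expect p P Φ + expect p P Ψ := by
  simp only [expect, mul_add, Finset.sum_add_distrib]

theorem expect_sum {ι : Type*} (p : α → ℝ) (P : Finset α) (J : Finset ι)
    (Φ : ι → Finset α → ℝ) :
    expect p P (fun T => ∑ j ∈ J, Φ j T) = ∑ j ∈ J, expect p P (Φ j) := by
  simp only [expect, Finset.mul_sum]
  rw [Finset.sum_comm]

theorem exists_le_expect {p : α → ℝ} {P : Finset α} (h0 : ∀ y ∈ P, 0 ≤ p y)
    (h1 : ∀ y ∈ P, p y ≤ 1) (Φ : Finset α → ℝ) : ∃ T ⊆ P, Φ T ≤ expect p P Φ := by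
  by_contra! h
  have hs : ∑ T ∈ P.powerset, ((∏ y ∈ T, p y) * ∏ y ∈ P \ T, (1 - p y)) = 1 := by
    rw [← Finset.prod_add]
    simp
  have hle : ∑ T ∈ P.powerset, ((∏ y ∈ T, p y) * ∏ y ∈ P \ T, (1 - p y)) * expect p P Φ <
      ∑ T ∈ P.powerset, ((∏ y ∈ T, p y) * ∏ y ∈ P \ T, (1 - p y)) * Φ T := by
    have hw : ∀ T ∈ P.powerset, 0 ≤ (∏ y ∈ T, p y) * ∏ y ∈ P \ T, (1 - p y) := fun T hT =>
      mul_nonneg (Finset.prod_nonneg fun y hy => h0 y (Finset.mem_powerset.1 hT hy))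
        (Finset.prod_nonneg fun y hy => sub_nonneg.2 (h1 y (Finset.mem_sdiff.1 hy).1))
    obtain ⟨T, hT, hT0⟩ := Finset.exists_ne_zero_of_sum_ne_zero (hs.trans_ne one_ne_zero)
    exact Finset.sum_lt_sum
      (fun T hT => mul_le_mul_of_nonneg_left (h T (Finset.mem_powerset.1 hT)).le (hw T hT))
      ⟨T, hT, mul_lt_mul_of_pos_left (h T (Finset.mem_powerset.1 hT))
        ((hw T hT).lt_of_ne hT0.symm)⟩
  rw [← Finset.sum_mul, hs, one_mul] at hle
  exact lt_irrefl _ hle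

/-- By independence the moment factors over `P`, and each factor is `1 + p y * (exp z - 1)` or `1`.
The constant `c` carries the threshold of a Chernoff bound. -/
theorem expect_exp_le {p : α → ℝ} {P : Finset α} (h0 : ∀ y ∈ P, 0 ≤ p y)
    (h1 : ∀ y ∈ P, p y ≤ 1) (S : Finset α) (z c : ℝ) :
    expect p P (fun T => Real.exp (z * (T ∩ S).card + c)) ≤
      Real.exp ((Real.exp z - 1) * ∑ y ∈ P ∩ S, p y + c) := by
  have h : expect p P (fun T => Real.exp (z * (T ∩ S).card + c)) =
      (∏ y ∈ P, (p y * (if y ∈ S then Real.exp z else 1) + (1 - p y))) * Real.exp c := by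
    rw [Finset.prod_add, Finset.sum_mul]
    refine Finset.sum_congr rfl fun T _ => ?_
    beta_reduce
    rw [Finset.prod_mul_distrib, ← Finset.prod_filter, Finset.prod_const, Real.exp_add,
      Finset.filter_mem_eq_inter, mul_comm z, Real.exp_nat_mul]
    ring
  rw [h, Real.exp_add]
  refine mul_le_mul_of_nonneg_right ?_ (Real.exp_pos _).le
  have h2 : (Real.exp z - 1) * ∑ y ∈ P ∩ S, p y =
      ∑ y ∈ P, if y ∈ S then (Real.exp z - 1) * p y else 0 := by
    rw [Finset.mul_sum, ← Finset.sum_filter, Finset.filter_mem_eq_inter]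
  rw [h2, Real.exp_sum]
  refine Finset.prod_le_prod (fun y hy => ?_) fun y hy => ?_
  · have := h0 y hy
    have := h1 y hy
    split_ifs
    · have := Real.exp_pos z
      nlinarith [mul_nonneg (h0 y hy) this.le]
    · linarith
  · split_ifs
    · refine le_trans (le_of_eq ?_) (Real.add_one_le_exp _)
      ring
    · simp

theorem expect_exp_deviation_le {p : α → ℝ} {P : Finset α} (h0 : ∀ y ∈ P, 0 ≤ p y)
    (h1 : ∀ y ∈ P, p y ≤ 1) (S : Finset α) {z c : ℝ} (hz : |z| ≤ 1) :
    expect p P (fun T => Real.exp (z * ((T ∩ S).card - ∑ y ∈ P ∩ S, p y) + c)) ≤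
      Real.exp (z ^ 2 * ∑ y ∈ P ∩ S, p y + c) := by
  have h := expect_exp_le h0 h1 S z (c - z * ∑ y ∈ P ∩ S, p y)
  have e : (fun T : Finset α => Real.exp (z * ((T ∩ S).card - ∑ y ∈ P ∩ S, p y) + c)) =
      fun T => Real.exp (z * (T ∩ S).card + (c - z * ∑ y ∈ P ∩ S, p y)) := by
    funext T
    congr 1
    ring
  rw [e]
  refine h.trans (Real.exp_le_exp.2 ?_)
  have hq : Real.exp z - 1 - z ≤ z ^ 2 := (abs_le.1 (Real.abs_exp_sub_one_sub_id_le hz)).2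
  have hp : 0 ≤ ∑ y ∈ P ∩ S, p y :=
    Finset.sum_nonneg fun y hy => h0 y (Finset.mem_inter.1 hy).1
  nlinarith

/-- Sampling the elements `y ∈ P`, all of weight below `τ`, with probability `w y / τ` keeps all
the weights of sets of the family. -/
theorem exists_sample {F : Finset (Finset α)} {w : α → ℝ} (hw : ∀ y, 0 < w y) {τ δ : ℝ}
    (hτ : 0 < τ) (hδ : 0 < δ) (hδ1 : δ ≤ 1) {P : Finset α} (hP : ∀ y ∈ P, w y ≤ τ)
    (hF : ∑ S ∈ F, Real.exp (-(δ ^ 2 / 4 * ((∑ y ∈ S, w y) / τ))) ≤ 1 / 4) :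
    ∃ T ⊆ P, (T.card : ℝ) ≤ 2 * ((∑ y ∈ P, w y) / τ) + 1 ∧
      ∀ S ∈ F, |τ * (T ∩ S).card - ∑ y ∈ P ∩ S, w y| ≤ δ * ∑ y ∈ S, w y := by
  set p : α → ℝ := fun y => w y / τ with hp
  have h0 : ∀ y ∈ P, 0 ≤ p y := fun y _ => div_nonneg (hw y).le hτ.le
  have h1 : ∀ y ∈ P, p y ≤ 1 := fun y hy => (div_le_one hτ).2 (hP y hy)
  set x : Finset α → ℝ := fun S => (∑ y ∈ S, w y) / τ with hx
  have hpx : ∀ S, ∑ y ∈ P ∩ S, p y ≤ x S := fun S => by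
    rw [hp, hx, ← Finset.sum_div]
    exact div_le_div_of_nonneg_right (Finset.sum_le_sum_of_subset_of_nonneg
      Finset.inter_subset_right fun y _ _ => (hw y).le) hτ.le
  -- `A` and `B` reach `1` when `S` deviates too far up or down, and `E` when the sample is too
  -- large. Their total expectation is below `1`, so some outcome has every exponent negative.
  set A : Finset α → Finset α → ℝ := fun S T =>
    Real.exp (δ / 2 * ((T ∩ S).card - ∑ y ∈ P ∩ S, p y) + -(δ / 2 * (δ * x S)))
  set B : Finset α → Finset α → ℝ := fun S T =>
    Real.exp (-(δ / 2) * ((T ∩ S).card - ∑ y ∈ P ∩ S, p y) + -(δ / 2 * (δ * x S)))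
  set E : Finset α → ℝ := fun T =>
    Real.exp (1 * (T ∩ P).card + (-(2 * x P) - 1))
  obtain ⟨T, hTP, hT⟩ := exists_le_expect h0 h1
    (fun T => (∑ S ∈ F, A S T + ∑ S ∈ F, B S T) + E T)
  rw [expect_add, expect_add, expect_sum, expect_sum] at hT
  -- The choice `z = ± δ / 2` gives the variance term `δ ^ 2 / 4 * x` against the threshold `δ ^ 2 /
  -- 2 * x`.
  have hz : ∀ S, (δ / 2) ^ 2 * ∑ y ∈ P ∩ S, p y + -(δ / 2 * (δ * x S)) ≤
      -(δ ^ 2 / 4 * x S) := fun S => by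
    have := mul_le_mul_of_nonneg_left (hpx S) (sq_nonneg (δ / 2))
    nlinarith
  have hA : ∑ S ∈ F, expect p P (A S) ≤ 1 / 4 := by
    refine le_trans (Finset.sum_le_sum fun S _ => ?_) hF
    refine (expect_exp_deviation_le h0 h1 S ?_).trans (Real.exp_le_exp.2 (hz S))
    rw [abs_of_pos (by linarith)]
    linarith
  have hB : ∑ S ∈ F, expect p P (B S) ≤ 1 / 4 := by
    refine le_trans (Finset.sum_le_sum fun S _ => ?_) hF
    refine (expect_exp_deviation_le h0 h1 S ?_).trans (Real.exp_le_exp.2 ?_)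
    · rw [abs_neg, abs_of_pos (by linarith)]
      linarith
    · rw [neg_sq]
      exact hz S
  have hE : expect p P E < 1 / 2 := by
    refine (expect_exp_le h0 h1 P 1 _).trans_lt ?_
    have hxP : ∑ y ∈ P ∩ P, p y = x P := by
      rw [Finset.inter_self, hp, hx, ← Finset.sum_div]
    have hxP0 : 0 ≤ x P := div_nonneg (Finset.sum_nonneg fun y _ => (hw y).le) hτ.le
    have he : Real.exp 1 - 1 ≤ 2 := by linarith [Real.exp_one_lt_d9]
    have h3 : Real.exp ((Real.exp 1 - 1) * ∑ y ∈ P ∩ P, p y + (-(2 * x P) - 1)) ≤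
        Real.exp (-1) := by
      rw [Real.exp_le_exp, hxP]
      nlinarith
    refine h3.trans_lt ?_
    rw [Real.exp_neg, one_div]
    exact inv_strictAnti₀ (by norm_num) (by linarith [Real.exp_one_gt_d9])
  have htot : (∑ S ∈ F, A S T + ∑ S ∈ F, B S T) + E T < 1 := by linarith
  have hA0 : 0 ≤ ∑ S ∈ F, A S T := Finset.sum_nonneg fun _ _ => (Real.exp_pos _).le
  have hB0 : 0 ≤ ∑ S ∈ F, B S T := Finset.sum_nonneg fun _ _ => (Real.exp_pos _).le
  have hE0 : 0 ≤ E T := (Real.exp_pos _).le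
  refine ⟨T, hTP, ?_, fun S hS => ?_⟩
  · have h4 : E T < 1 := by linarith
    have h5 := Real.exp_lt_one_iff.1 h4
    rw [Finset.inter_eq_left.2 hTP] at h5
    linarith
  · have h4 : A S T < 1 := by
      have := Finset.single_le_sum (f := fun S => A S T)
        (fun _ _ => (Real.exp_pos _).le) hS
      linarith
    have h5 : B S T < 1 := by
      have := Finset.single_le_sum (f := fun S => B S T)
        (fun _ _ => (Real.exp_pos _).le) hS
      linarith
    have h4' := Real.exp_lt_one_iff.1 h4
    have h5' := Real.exp_lt_one_iff.1 h5
    have h6 : (T ∩ S).card - ∑ y ∈ P ∩ S, p y ≤ δ * x S := by nlinarith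
    have h7 : -(δ * x S) ≤ (T ∩ S).card - ∑ y ∈ P ∩ S, p y := by nlinarith
    have h8 : τ * (T ∩ S).card - ∑ y ∈ P ∩ S, w y =
        τ * ((T ∩ S).card - ∑ y ∈ P ∩ S, p y) := by
      rw [hp, ← Finset.sum_div]
      field_simp
    have h9 : δ * ∑ y ∈ S, w y = τ * (δ * x S) := by
      rw [hx]
      field_simp
    rw [h8, h9, abs_mul, abs_of_pos hτ]
    exact mul_le_mul_of_nonneg_left (abs_le.2 ⟨h7, h6⟩) hτ.le

/-- Sparsification of a group `G` of elements of comparable strength. -/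
theorem Dense.exists_group_sparsifier {F : Finset (Finset α)} {w : α → ℝ} (hw : ∀ y, 0 < w y)
    {k δ A b : ℝ} {m ℓ : ℕ} (hk : 0 < k) (hδ : 0 < δ) (hδ1 : δ ≤ 1) (hA : 1 ≤ A) (hb : 0 ≤ b)
    (hF : Dense F w k) (hm : (support F).card ≤ m)
    (hq : ((m : ℝ) + 1) * Real.exp (-(b / 2)) ≤ 1 / 8)
    (hAb : b + 2 * (harmonic m : ℝ) ≤ δ ^ 2 / 4 * A) {G : Finset α} (hℓ : 1 ≤ ℓ)
    (hG : ∑ y ∈ G, w y ≤ 2 * k * ℓ) (hGF : G ⊆ support F) :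
    ∃ w' : α → ℝ, (∀ y, 0 ≤ w' y) ∧ ((G.filter (w' · ≠ 0)).card : ℝ) ≤ 7 * A * ℓ ∧
      ∀ S ∈ F, |∑ y ∈ S ∩ G, w' y - ∑ y ∈ S ∩ G, w y| ≤
        min (δ * ∑ y ∈ S, w y) ((m + 2 * ℓ) * k) := by
  have hA0 : 0 < A := by linarith
  -- Elements heavier than `τ` keep their weight; the others are sampled with probability `w y / τ`
  -- and get weight `τ`.
  set τ := k / A with hτdef
  have hτ : 0 < τ := div_pos hk hA0
  have hτk : τ ≤ k := div_le_self hk.le hA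
  set P := G.filter (w · ≤ τ) with hPdef
  set Q := G.filter (¬ w · ≤ τ) with hQdef
  have hl1 : (1 : ℝ) ≤ ℓ := by exact_mod_cast hℓ
  have hsum : ∑ S ∈ F.filter (·.Nonempty),
      Real.exp (-(δ ^ 2 / 4 * ((∑ y ∈ S, w y) / τ))) ≤ 1 / 4 := by
    have h1 := hF.sum_exp_le hw hk hb (support F) (support F).card F subset_rfl
      (rank_le_card_support F)
    refine le_trans (Finset.sum_le_sum fun S _ => ?_) (h1.trans ?_)
    · rw [Real.exp_le_exp, neg_le_neg_iff]
      have hx : 0 ≤ (∑ y ∈ S, w y) / k :=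
        div_nonneg (Finset.sum_nonneg fun y _ => (hw y).le) hk.le
      have h2 : (∑ y ∈ S, w y) / τ = A * ((∑ y ∈ S, w y) / k) := by
        rw [hτdef]
        field_simp
      have h3 : (harmonic (support F).card : ℝ) ≤ harmonic m := by
        have : harmonic (support F).card ≤ harmonic m :=
          Finset.sum_le_sum_of_subset_of_nonneg (Finset.range_mono hm)
            fun i _ _ => by positivity
        exact_mod_cast this
      rw [h2, ← mul_assoc]
      exact mul_le_mul_of_nonneg_right (by linarith) hx
    · set q := ((support F).card + 1 : ℝ) * Real.exp (-(b / 2)) with hqdef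
      have hq0 : 0 ≤ q := by positivity
      have hq8 : q ≤ 1 / 8 := le_trans (mul_le_mul_of_nonneg_right
        (by have : ((support F).card : ℝ) ≤ m := by exact_mod_cast hm
            linarith) (Real.exp_pos _).le) hq
      have hgeom : ∀ n : ℕ, ∑ j ∈ Finset.range n, q ^ (j + 1) ≤ 1 / 4 - q ^ n / 4 := by
        intro n
        induction n with
        | zero => norm_num
        | succ n ih =>
          rw [Finset.sum_range_succ, pow_succ]
          nlinarith [mul_le_mul_of_nonneg_left hq8 (pow_nonneg hq0 n), pow_nonneg hq0 n]
      exact (hgeom _).trans (by linarith [pow_nonneg hq0 (support F).card])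
  obtain ⟨T, hTP, hTcard, hT⟩ := exists_sample (F := F.filter (·.Nonempty)) hw hτ hδ hδ1
    (P := P) (fun y hy => (Finset.mem_filter.1 hy).2) hsum
  have hTG : T ⊆ G := hTP.trans (Finset.filter_subset _ _)
  set w' : α → ℝ := fun y => if w y ≤ τ then (if y ∈ T then τ else 0) else w y with hw'
  have hw'0 : ∀ y, 0 ≤ w' y := fun y => by
    simp only [hw']
    split_ifs
    exacts [hτ.le, le_rfl, (hw y).le]
  have hw'le : ∀ y, w' y ≤ w y + k := fun y => by
    have := hw y
    simp only [hw']
    split_ifs <;> linarith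
  refine ⟨w', hw'0, ?_, fun S hS => le_min ?_ ?_⟩
  · have hsub : G.filter (w' · ≠ 0) ⊆ T ∪ Q := by
      intro y hy
      obtain ⟨hyG, hy0⟩ := Finset.mem_filter.1 hy
      by_cases h : w y ≤ τ
      · refine Finset.mem_union_left _ ?_
        by_contra hyT
        simp [hw', h, hyT] at hy0
      · exact Finset.mem_union_right _ (Finset.mem_filter.2 ⟨hyG, h⟩)
    have h1 : ((G.filter (w' · ≠ 0)).card : ℝ) ≤ T.card + Q.card := by
      exact_mod_cast (Finset.card_le_card hsub).trans (Finset.card_union_le _ _)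
    have h2 : (Q.card : ℝ) * τ ≤ ∑ y ∈ Q, w y := by
      rw [← nsmul_eq_mul]
      exact Finset.card_nsmul_le_sum _ _ _ fun y hy => (not_le.1 (Finset.mem_filter.1 hy).2).le
    have h3 : ∑ y ∈ P, w y + ∑ y ∈ Q, w y = ∑ y ∈ G, w y :=
      Finset.sum_filter_add_sum_filter_not _ _ _
    have hP0 : 0 ≤ ∑ y ∈ P, w y := Finset.sum_nonneg fun y _ => (hw y).le
    have hQ0 : 0 ≤ ∑ y ∈ Q, w y := Finset.sum_nonneg fun y _ => (hw y).le
    have h4 : (∑ y ∈ G, w y) / τ ≤ 2 * A * ℓ := by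
      rw [div_le_iff₀ hτ, hτdef]
      calc _ ≤ 2 * k * ℓ := hG
        _ = _ := by field_simp
    have h5 : (∑ y ∈ P, w y) / τ + Q.card ≤ 2 * A * ℓ := by
      refine le_trans ?_ h4
      rw [← h3, add_div]
      gcongr
      rwa [le_div_iff₀ hτ]
    have h6 : 1 ≤ A * ℓ := one_le_mul_of_one_le_of_one_le hA hl1
    have h7 : (0 : ℝ) ≤ Q.card := Nat.cast_nonneg _
    nlinarith
  · rcases S.eq_empty_or_nonempty with rfl | hne
    · simp
    have hdec : ∀ f : α → ℝ, ∑ y ∈ S ∩ G, f y =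
        ∑ y ∈ P ∩ S, f y + ∑ y ∈ (S ∩ G).filter (¬ w · ≤ τ), f y := fun f => by
      have : P ∩ S = (S ∩ G).filter (w · ≤ τ) := by
        ext y
        simp only [hPdef, Finset.mem_inter, Finset.mem_filter]
        tauto
      rw [this]
      exact (Finset.sum_filter_add_sum_filter_not _ _ _).symm
    have h1 : ∑ y ∈ (S ∩ G).filter (¬ w · ≤ τ), w' y =
        ∑ y ∈ (S ∩ G).filter (¬ w · ≤ τ), w y :=
      Finset.sum_congr rfl fun y hy => if_neg (Finset.mem_filter.1 hy).2
    have h2 : ∑ y ∈ P ∩ S, w' y = τ * (T ∩ S).card := by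
      have : ∀ y ∈ P ∩ S, w' y = if y ∈ T then τ else 0 := fun y hy =>
        if_pos (Finset.mem_filter.1 (Finset.mem_inter.1 hy).1).2
      rw [Finset.sum_congr rfl this, ← Finset.sum_filter, Finset.sum_const, nsmul_eq_mul,
        mul_comm]
      congr 3
      ext y
      have := @hTP y
      simp only [Finset.mem_inter, Finset.mem_filter]
      tauto
    rw [hdec w', hdec w, h1, h2, add_sub_add_right_eq_sub]
    exact hT S (Finset.mem_filter.2 ⟨hS, hne⟩)
  -- The second bound on the error is crude but does not grow with the weight of `S`; it makes
  -- levels far below that weight summable.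
  · have h1 : ∑ y ∈ S ∩ G, w y ≤ 2 * k * ℓ := (Finset.sum_le_sum_of_subset_of_nonneg
      Finset.inter_subset_right fun y _ _ => (hw y).le).trans hG
    have h2 : ∑ y ∈ S ∩ G, w' y ≤ ∑ y ∈ S ∩ G, w y + m * k := by
      refine (Finset.sum_le_sum fun y _ => hw'le y).trans ?_
      rw [Finset.sum_add_distrib, Finset.sum_const, nsmul_eq_mul]
      have h3 : ((S ∩ G).card : ℝ) ≤ m := by
        exact_mod_cast (Finset.card_le_card (Finset.inter_subset_right.trans hGF)).trans hm
      gcongr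
    have h3 : 0 ≤ ∑ y ∈ S ∩ G, w' y := Finset.sum_nonneg fun y _ => hw'0 y
    have h4 : 0 ≤ ∑ y ∈ S ∩ G, w y := Finset.sum_nonneg fun y _ => (hw y).le
    have h5 : 0 ≤ (m : ℝ) * k := by positivity
    rw [abs_le]
    constructor <;> nlinarith

/-! ### Sparsification of set families -/

/-- The error accumulated over `N` dyadic strength levels, starting at `k`, on a set of weight
`x`. -/
noncomputable def levelError (δ M : ℝ) : ℕ → ℝ → ℝ → ℝ
  | 0, _, _ => 0
  | N + 1, x, k => (if k ≤ x then min (δ * x) (M * k) else 0) + levelError δ M N x (2 * k)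

theorem levelError_mono {δ M : ℝ} (hδ : 0 ≤ δ) (hM : 0 ≤ M) (N : ℕ) {x x' : ℝ} (hx : 0 ≤ x)
    (h : x ≤ x') : ∀ {k : ℝ}, 0 ≤ k → levelError δ M N x k ≤ levelError δ M N x' k := by
  induction N with
  | zero => exact fun _ => le_rfl
  | succ N ih =>
    intro k hk
    refine add_le_add ?_ (ih (by linarith))
    split_ifs with h1 h2 h2
    · exact min_le_min_right _ (mul_le_mul_of_nonneg_left h hδ)
    · exact absurd (h1.trans h) h2
    · exact le_min (mul_nonneg hδ (hx.trans h)) (mul_nonneg hM hk)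
    · exact le_rfl

theorem levelError_eq_zero {δ M : ℝ} (N : ℕ) {x : ℝ} (hx : 0 ≤ x) :
    ∀ {k : ℝ}, x < k → levelError δ M N x k = 0 := by
  induction N with
  | zero => exact fun _ => rfl
  | succ N ih =>
    intro k hk
    rw [levelError, if_neg (not_le.2 hk), ih (by linarith), add_zero]

theorem levelError_le_logb {δ M : ℝ} (hδ : 0 ≤ δ) (N : ℕ) {x : ℝ} (hx : 0 ≤ x) :
    ∀ {k : ℝ}, 0 < k → k ≤ x → levelError δ M N x k ≤ δ * x * (1 + Real.logb 2 (x / k)) := by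
  induction N with
  | zero =>
    intro k hk hkx
    have : 0 ≤ Real.logb 2 (x / k) := Real.logb_nonneg (by norm_num) ((one_le_div hk).2 hkx)
    exact mul_nonneg (mul_nonneg hδ hx) (by linarith)
  | succ N ih =>
    intro k hk hkx
    rw [levelError, if_pos hkx]
    have h0 : 0 ≤ Real.logb 2 (x / k) := Real.logb_nonneg (by norm_num) ((one_le_div hk).2 hkx)
    have hδx := mul_nonneg hδ hx
    by_cases h : 2 * k ≤ x
    · have h1 := ih (k := 2 * k) (by linarith) h
      have hx' : x ≠ 0 := by linarith
      have h2 : Real.logb 2 (x / (2 * k)) = Real.logb 2 (x / k) - 1 := by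
        rw [mul_comm, ← div_div, Real.logb_div (div_ne_zero hx' hk.ne') two_ne_zero,
          Real.logb_self_eq_one one_lt_two]
      rw [h2] at h1
      have := min_le_left (δ * x) (M * k)
      linarith
    · rw [levelError_eq_zero N hx (not_le.1 h)]
      have := min_le_left (δ * x) (M * k)
      nlinarith [mul_nonneg hδx h0]

/-- Levels with `M * k ≤ δ * x` cost at most `M * k` each, a geometric sum; levels above `x` cost
nothing; the roughly `log₂ (M / δ)` levels between cost at most `δ * x` each. -/
theorem levelError_le {δ M : ℝ} (hδ : 0 < δ) (hM : δ ≤ M) (N : ℕ) {x : ℝ} (hx : 0 < x) :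
    ∀ {k : ℝ}, 0 < k →
      levelError δ M N x k ≤ δ * x * (4 + Real.logb 2 (M / δ)) := by
  have hM0 : 0 < M := by linarith
  have hlog : 0 ≤ Real.logb 2 (M / δ) :=
    Real.logb_nonneg one_lt_two ((one_le_div hδ).2 hM)
  have hδx : 0 < δ * x := mul_pos hδ hx
  have hlarge : ∀ (N : ℕ) {k : ℝ}, 0 < k → δ * x ≤ M * k →
      levelError δ M N x k ≤ δ * x * (1 + Real.logb 2 (M / δ)) := by
    intro N k hk h
    by_cases hkx : k ≤ x
    · refine (levelError_le_logb hδ.le N hx.le hk hkx).trans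
        (mul_le_mul_of_nonneg_left (add_le_add_right ?_ 1) hδx.le)
      refine Real.logb_le_logb_of_le one_lt_two (by positivity) ?_
      rw [div_le_div_iff₀ hk hδ]
      linarith
    · rw [levelError_eq_zero N hx.le (not_le.1 hkx)]
      exact mul_nonneg hδx.le (by linarith)
  -- The slack `2 * (M * k)` makes the induction close: it doubles with `k`. At the switch to
  -- `hlarge` the requirement is `3 * (M * k) ≤ 3 * (δ * x)`, whence `4 = 1 + 3`.
  have hsmall : ∀ (N : ℕ) {k : ℝ}, 0 < k → M * k ≤ δ * x →
      levelError δ M N x k ≤ δ * x * (4 + Real.logb 2 (M / δ)) - 2 * (M * k) := by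
    intro N
    induction N with
    | zero =>
      intro k hk h
      rw [levelError]
      nlinarith [mul_nonneg hδx.le hlog]
    | succ N ih =>
      intro k hk h
      have h1 : (if k ≤ x then min (δ * x) (M * k) else 0) ≤ M * k := by
        split_ifs
        · exact min_le_right _ _
        · positivity
      rw [levelError]
      rcases le_total (M * (2 * k)) (δ * x) with h2 | h2
      · have := ih (k := 2 * k) (by linarith) h2
        have : 0 < M * k := by positivity
        linarith
      · have := hlarge N (k := 2 * k) (by linarith) h2
        linarith
  intro k hk
  rcases le_total (M * k) (δ * x) with h | h
  · have : 0 < M * k := by positivity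
    linarith [hsmall N hk h]
  · linarith [hlarge N hk h]

/-- The sets of `F` with the elements of `V` removed. -/
def puncture (F : Finset (Finset α)) (V : Finset α) : Finset (Finset α) := F.image (· \ V)

theorem exists_of_mem_puncture {F : Finset (Finset α)} {V S' : Finset α}
    (h : S' ∈ puncture F V) : ∃ S ∈ F, S \ V = S' := Finset.mem_image.1 h

theorem support_puncture_subset (F : Finset (Finset α)) (V : Finset α) :
    support (puncture F V) ⊆ support F \ V := by
  intro y hy
  obtain ⟨S', hS', hyS⟩ := mem_support.1 hy
  obtain ⟨S, hS, rfl⟩ := exists_of_mem_puncture hS'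
  obtain ⟨h1, h2⟩ := Finset.mem_sdiff.1 hyS
  exact Finset.mem_sdiff.2 ⟨subset_support hS h1, h2⟩

/-- Take `H` of maximal support among the subfamilies of weight at most `k * rank H`. A subfamily
violating density after puncturing could be lifted and joined to `H`, by superadditivity of rank,
contradicting maximality. -/
theorem Dense.exists_puncture {w : α → ℝ} (F : Finset (Finset α)) {k : ℝ} (hk : 0 ≤ k) :
    ∃ H ⊆ F, ∑ y ∈ support H, w y ≤ k * rank H ∧
      Dense (puncture F (support H)) w k := by
  obtain ⟨H, hH, hmax⟩ := Finset.exists_max_image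
    (F.powerset.filter fun H => ∑ y ∈ support H, w y ≤ k * rank H)
    (fun H => (support H).card) ⟨∅, Finset.mem_filter.2 ⟨Finset.empty_mem_powerset F, by
      simp only [support, Finset.biUnion_empty, Finset.sum_empty]
      positivity⟩⟩
  obtain ⟨hHF, hHk⟩ := Finset.mem_filter.1 hH
  rw [Finset.mem_powerset] at hHF
  refine ⟨H, hHF, hHk, fun K hK => ?_⟩
  by_contra! hlt
  set V := support H with hV
  set J := H ∪ F.filter fun S => S \ V ∈ K with hJ
  have hKF : ∀ S' ∈ K, ∃ S ∈ J, S \ V = S' := fun S' hS' => by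
    obtain ⟨S, hS, rfl⟩ := exists_of_mem_puncture (hK hS')
    exact ⟨S, Finset.mem_union_right _ (Finset.mem_filter.2 ⟨hS, hS'⟩), rfl⟩
  have hrank : rank H + rank K ≤ rank J :=
    rank_add_rank_le Finset.subset_union_left (fun S hS => subset_support hS) hKF
  have hdisj : Disjoint V (support K) := by
    rw [Finset.disjoint_right]
    exact fun y hy => (Finset.mem_sdiff.1 (support_puncture_subset F V (support_mono hK hy))).2
  have hsupp : support J = V ∪ support K := by
    ext y
    simp only [hJ, Finset.mem_union, mem_support, hV, Finset.mem_filter]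
    constructor
    · rintro ⟨S, hS | ⟨hS, hSK⟩, hy⟩
      · exact Or.inl ⟨S, hS, hy⟩
      · by_cases hyV : y ∈ V
        · exact Or.inl (mem_support.1 hyV)
        · exact Or.inr ⟨_, hSK, Finset.mem_sdiff.2 ⟨hy, hyV⟩⟩
    · rintro (⟨S, hS, hy⟩ | ⟨S', hS', hy⟩)
      · exact ⟨S, Or.inl hS, hy⟩
      · obtain ⟨S, hS, rfl⟩ := exists_of_mem_puncture (hK hS')
        exact ⟨S, Or.inr ⟨hS, hS'⟩, (Finset.mem_sdiff.1 hy).1⟩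
  have hJ' : J ∈ F.powerset.filter fun H => ∑ y ∈ support H, w y ≤ k * rank H := by
    refine Finset.mem_filter.2 ⟨Finset.mem_powerset.2
      (Finset.union_subset hHF (Finset.filter_subset _ _)), ?_⟩
    rw [hsupp, Finset.sum_union hdisj]
    have : ((rank H : ℝ) + rank K) ≤ rank J := by exact_mod_cast hrank
    nlinarith
  have hcard := hmax J hJ'
  rw [hsupp, Finset.card_union_of_disjoint hdisj] at hcard
  have hem : support K = ∅ := Finset.card_eq_zero.1 (by lia)
  have hr : rank K = 0 := Nat.le_zero.1 ((rank_le_card_support K).trans (by simp [hem]))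
  simp [hr, hem] at hlt

/-- Each step sparsifies the group at strength `k` and recurses at `2 * k` on the punctured family.
Density bounds every nonempty set below by `k`, so after `N` doublings only empty sets remain. -/
theorem exists_level_sparsifier {w : α → ℝ} (hw : ∀ y, 0 < w y) {δ A b : ℝ} {m : ℕ}
    (hδ : 0 < δ) (hδ1 : δ ≤ 1) (hA : 1 ≤ A) (hb : 0 ≤ b)
    (hq : ((m : ℝ) + 1) * Real.exp (-(b / 2)) ≤ 1 / 8)
    (hAb : b + 2 * (harmonic m : ℝ) ≤ δ ^ 2 / 4 * A) (N : ℕ) :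
    ∀ (F : Finset (Finset α)) (k : ℝ), 0 < k → Dense F w k → (support F).card ≤ m →
      ∑ y ∈ support F, w y < k * 2 ^ N →
      ∃ w' : α → ℝ, (∀ y, 0 ≤ w' y) ∧
        (((support F).filter (w' · ≠ 0)).card : ℝ) ≤ 7 * A * rank F ∧
        ∀ S ∈ F, |∑ y ∈ S, w' y - ∑ y ∈ S, w y| ≤
          levelError δ (3 * m) N (∑ y ∈ S, w y) k := by
  induction N with
  | zero =>
    intro F k hk hF _ hlt
    have hem : ∀ S ∈ F, S = ∅ := by
      intro S hS
      by_contra hne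
      have h1 := hF.le_sum hk.le hS (Finset.nonempty_iff_ne_empty.2 hne)
      have h2 : ∑ y ∈ S, w y ≤ ∑ y ∈ support F, w y :=
        Finset.sum_le_sum_of_subset_of_nonneg (subset_support hS) fun y _ _ => (hw y).le
      linarith
    refine ⟨0, fun _ => le_rfl, ?_, fun S hS => ?_⟩
    · simp
      positivity
    · simp [hem S hS, levelError]
  | succ N ih =>
    intro F k hk hF hm hlt
    obtain ⟨H, hHF, hHk, hD⟩ := Dense.exists_puncture (w := w) F (k := 2 * k) (by linarith)
    set G := support H with hG
    have hGF : G ⊆ support F := support_mono hHF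
    have hsub := support_puncture_subset F G
    have hsub' : support (puncture F G) ⊆ support F := hsub.trans Finset.sdiff_subset
    obtain ⟨w₂, hw₂, hcard₂, herr₂⟩ := ih (puncture F G) (2 * k) (by linarith) hD
      ((Finset.card_le_card hsub').trans hm)
      (lt_of_le_of_lt (Finset.sum_le_sum_of_subset_of_nonneg hsub' fun y _ _ => (hw y).le)
        (by rw [pow_succ] at hlt; linarith))
    have hrank : rank H + rank (puncture F G) ≤ rank F :=
      rank_add_rank_le hHF (fun S hS => subset_support hS) fun _ => exists_of_mem_puncture
    have hrank' : (rank H : ℝ) + rank (puncture F G) ≤ rank F := by exact_mod_cast hrank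
    obtain ⟨w₁, hw₁, hcard₁, herr₁⟩ : ∃ w₁ : α → ℝ, (∀ y, 0 ≤ w₁ y) ∧
        ((G.filter (w₁ · ≠ 0)).card : ℝ) ≤ 7 * A * rank H ∧
        ∀ S ∈ F, |∑ y ∈ S ∩ G, w₁ y - ∑ y ∈ S ∩ G, w y| ≤
          min (δ * ∑ y ∈ S, w y) (3 * m * k) := by
      -- The group lemma needs a positive rank; rank zero means that the group is empty.
      rcases Nat.eq_zero_or_pos (rank H) with h | h
      · have hGem : G = ∅ := by
          by_contra hne
          obtain ⟨y, hy⟩ := Finset.nonempty_iff_ne_empty.2 hne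
          have := rank_filter_notMem_lt hy
          lia
        refine ⟨0, fun _ => le_rfl, by simp [h], fun S _ => ?_⟩
        rw [hGem, Finset.inter_empty, Finset.sum_empty, Finset.sum_empty, sub_zero, abs_zero]
        exact le_min (mul_nonneg hδ.le (Finset.sum_nonneg fun y _ => (hw y).le)) (by positivity)
      · obtain ⟨w₁, h1, h2, h3⟩ := hF.exists_group_sparsifier hw hk hδ hδ1 hA hb hm hq hAb h
          hHk hGF
        refine ⟨w₁, h1, h2, fun S hS => (h3 S hS).trans (min_le_min_left _ ?_)⟩
        have : (rank H : ℝ) ≤ m := by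
          exact_mod_cast (rank_le_card_support H).trans ((Finset.card_le_card hGF).trans hm)
        exact mul_le_mul_of_nonneg_right (by linarith) hk.le
    refine ⟨fun y => if y ∈ G then w₁ y else if y ∈ support (puncture F G) then w₂ y else 0,
      fun y => ?_, ?_, fun S hS => ?_⟩
    · beta_reduce
      split_ifs
      exacts [hw₁ y, hw₂ y, le_rfl]
    · refine le_trans (b := ((G.filter (w₁ · ≠ 0)).card : ℝ) +
        ((support (puncture F G)).filter (w₂ · ≠ 0)).card) ?_ ?_
      · rw [← Nat.cast_add, Nat.cast_le]
        refine (Finset.card_le_card fun y hy => ?_).trans (Finset.card_union_le _ _)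
        have hy' := (Finset.mem_filter.1 hy).2
        beta_reduce at hy'
        split_ifs at hy' with h1 h2
        · exact Finset.mem_union_left _ (Finset.mem_filter.2 ⟨h1, hy'⟩)
        · exact Finset.mem_union_right _ (Finset.mem_filter.2 ⟨h2, hy'⟩)
        · exact absurd rfl hy'
      · nlinarith
    · have hS' : S \ G ∈ puncture F G := Finset.mem_image_of_mem _ hS
      have hx : ∑ y ∈ S \ G, w y ≤ ∑ y ∈ S, w y :=
        Finset.sum_le_sum_of_subset_of_nonneg Finset.sdiff_subset fun y _ _ => (hw y).le
      have hx0 : 0 ≤ ∑ y ∈ S \ G, w y := Finset.sum_nonneg fun y _ => (hw y).le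
      rcases S.eq_empty_or_nonempty with rfl | hne
      · rw [Finset.sum_empty, Finset.sum_empty, sub_zero, abs_zero,
          levelError_eq_zero _ le_rfl hk]
      rw [levelError, if_pos (hF.le_sum hk.le hS hne), ← Finset.sum_inter_add_sum_sdiff S G,
        ← Finset.sum_inter_add_sum_sdiff S G w, add_sub_add_comm]
      have e1 : ∑ y ∈ S ∩ G, (if y ∈ G then w₁ y else
          if y ∈ support (puncture F G) then w₂ y else 0) = ∑ y ∈ S ∩ G, w₁ y :=
        Finset.sum_congr rfl fun y hy => if_pos (Finset.mem_inter.1 hy).2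
      have e2 : ∑ y ∈ S \ G, (if y ∈ G then w₁ y else
          if y ∈ support (puncture F G) then w₂ y else 0) = ∑ y ∈ S \ G, w₂ y :=
        Finset.sum_congr rfl fun y hy => by
          rw [if_neg (Finset.mem_sdiff.1 hy).2, if_pos (subset_support hS' hy)]
      rw [e1, e2]
      refine (abs_add_le _ _).trans (add_le_add ?_ ?_)
      · rw [Finset.sum_inter_add_sum_sdiff S G w]
        exact herr₁ S hS
      · rw [Finset.sum_inter_add_sum_sdiff S G w]
        -- The recursion measures its error against the weight of `S \ G`, which is at most that of
        -- `S`.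
        exact (herr₂ _ hS').trans (levelError_mono hδ.le (by positivity) N hx0 hx (by linarith))

/-- Every weighted set family has a sparsifier whose size is controlled by its rank. -/
theorem exists_sparsifier [Fintype α] {w : α → ℝ} (hw : ∀ y, 0 < w y) {δ A b : ℝ} {m : ℕ}
    (hm : Fintype.card α ≤ m) (hm1 : 1 ≤ m) (hδ : 0 < δ) (hδ1 : δ ≤ 1) (hA : 1 ≤ A) (hb : 0 ≤ b)
    (hq : ((m : ℝ) + 1) * Real.exp (-(b / 2)) ≤ 1 / 8)
    (hAb : b + 2 * (harmonic m : ℝ) ≤ δ ^ 2 / 4 * A) (F : Finset (Finset α)) :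
    ∃ w' : α → ℝ, (∀ y, 0 ≤ w' y) ∧
      ((Finset.univ.filter (w' · ≠ 0)).card : ℝ) ≤ 7 * A * rank F ∧
      ∀ S ∈ F, |∑ y ∈ S, w' y - ∑ y ∈ S, w y| ≤
        δ * (4 + Real.logb 2 (3 * m / δ)) * ∑ y ∈ S, w y := by
  -- The least weight is a valid starting strength, since the rank is at most the size of the
  -- support.
  obtain ⟨k, hk, hkw⟩ : ∃ k > 0, ∀ y, k ≤ w y := by
    rcases isEmpty_or_nonempty α with h | h
    · exact ⟨1, one_pos, fun y => h.elim y⟩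
    · obtain ⟨y, hy⟩ := Finite.exists_min w
      exact ⟨w y, hw y, hy⟩
  have hD : Dense F w k := fun H _ => by
    have h1 : ((support H).card : ℝ) * k ≤ ∑ y ∈ support H, w y := by
      rw [← nsmul_eq_mul]
      exact Finset.card_nsmul_le_sum _ _ _ fun y _ => hkw y
    have h2 : (rank H : ℝ) ≤ (support H).card := by exact_mod_cast rank_le_card_support H
    nlinarith
  obtain ⟨N, hN⟩ := pow_unbounded_of_one_lt ((∑ y ∈ support F, w y) / k) one_lt_two
  rw [div_lt_iff₀ hk, mul_comm] at hN
  obtain ⟨w', hw', hcard, herr⟩ := exists_level_sparsifier hw hδ hδ1 hA hb hq hAb N F k hk hD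
    ((Finset.card_le_univ _).trans hm) hN
  refine ⟨fun y => if y ∈ support F then w' y else 0, fun y => ?_, ?_, fun S hS => ?_⟩
  · beta_reduce
    split_ifs
    exacts [hw' y, le_rfl]
  · refine le_trans (Nat.cast_le.2 (Finset.card_le_card fun y hy => ?_)) hcard
    have hy' := (Finset.mem_filter.1 hy).2
    beta_reduce at hy'
    split_ifs at hy' with h1
    · exact Finset.mem_filter.2 ⟨h1, hy'⟩
    · exact absurd rfl hy'
  · have e : ∑ y ∈ S, (if y ∈ support F then w' y else 0) = ∑ y ∈ S, w' y :=
      Finset.sum_congr rfl fun y hy => if_pos (subset_support hS hy)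
    rw [e]
    rcases S.eq_empty_or_nonempty with rfl | hne
    · simp
    · have hm' : (1 : ℝ) ≤ m := by exact_mod_cast hm1
      refine (herr S hS).trans ((levelError_le hδ (by linarith) N
        (Finset.sum_pos (fun y _ => hw y) hne) hk).trans (le_of_eq ?_))
      ring

end SetFamily

/-! ### The lower bound -/

namespace WeightedCSP

theorem sum_pow_lt_mul_le {B : ℝ} (hB : 1 < B) {q : ℕ} (i : Fin q) :
    (∑ j : Fin q, if j < i then B ^ (j : ℕ) else 0) * (B - 1) ≤ B ^ (i : ℕ) := by
  have h1 : (∑ j : Fin q, if j < i then B ^ (j : ℕ) else 0) ≤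
      ∑ j ∈ Finset.range i, B ^ j := by
    have := Fin.sum_univ_eq_sum_range (fun j => if j < (i : ℕ) then B ^ j else 0) q
    simp only [Fin.lt_def]
    rw [this, ← Finset.sum_filter]
    refine Finset.sum_le_sum_of_subset_of_nonneg (fun j hj => ?_) fun j _ _ => by positivity
    exact Finset.mem_range.2 (Finset.mem_filter.1 hj).2
  have h2 := geom_sum_mul B i
  have := mul_le_mul_of_nonneg_right h1 (sub_nonneg.2 hB.le)
  linarith

open Classical in
/-- With geometric weights, no clause of a triangular sequence can be dropped. -/
theorem le_wSPR_of_triangular {D : Type*} {r n q : ℕ} (R : Set (Fin r → D)) {ε : ℝ} (hε : 0 < ε)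
    (hε1 : ε < 1) (y : Fin q → Fin r → Fin n) (σ : Fin q → Fin n → D)
    (hd : ∀ i, (fun a => σ i (y i a)) ∈ R) (ht : ∀ i j, i < j → (fun a => σ i (y j a)) ∉ R) :
    q ≤ wSPR R n ε := by
  have hinj : Function.Injective y := by
    intro i j hij
    by_contra hne
    rcases lt_or_gt_of_ne hne with h | h
    · exact ht i j h (hij ▸ hd i)
    · exact ht j i h (hij.symm ▸ hd j)
  set Y : CSPInstance (Fin n) r := Finset.univ.image y with hY
  have hmem : ∀ i, y i ∈ Y := fun i => Finset.mem_image_of_mem _ (Finset.mem_univ i)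
  let e : Fin q ≃ Y := Equiv.ofBijective (fun i => ⟨y i, hmem i⟩)
    ⟨fun i j h => hinj (Subtype.ext_iff.1 h), fun ⟨c, hc⟩ => by
      obtain ⟨i, -, rfl⟩ := Finset.mem_image.1 hc
      exact ⟨i, rfl⟩⟩
  have hwt : ∀ (v : Y → ℝ) (τ : Fin n → D), wt R Y v τ =
      ∑ j, if (fun a => τ (y j a)) ∈ R then v (e j) else 0 := by
    intro v τ
    rw [wt, ← e.sum_comp]
    refine Finset.sum_congr rfl fun j _ => ?_
    rw [mul_ite, mul_one, mul_zero]
    rfl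
  -- Chosen so that `4 / (B - 1) < 1 - ε`: a sparsifier has `w' (e j) ≤ 4 * B ^ j`, so the clauses
  -- before `i` cannot replace clause `i`.
  set B : ℝ := 2 + 4 / (1 - ε) with hB
  have hε' : 0 < 1 - ε := by linarith
  have hB4 : 4 < (B - 1) * (1 - ε) := by
    rw [hB]
    field_simp
    linarith
  have hB2 : 2 ≤ B := by
    have : 0 < 4 / (1 - ε) := by positivity
    linarith
  set w : Y → ℝ := fun c => B ^ (e.symm c : ℕ) with hw
  have hwe : ∀ j, w (e j) = B ^ (j : ℕ) := fun j => by simp [hw]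
  have hpos : ∀ c, 0 < w c := fun c => by positivity
  have hgeom : ∀ i : Fin q, (∑ j : Fin q, if j < i then B ^ (j : ℕ) else 0) ≤
      B ^ (i : ℕ) / (B - 1) := fun i =>
    (le_div_iff₀ (by linarith)).2 (sum_pow_lt_mul_le (by linarith) i)
  have hsplit : ∀ (v : Y → ℝ), (∀ c, 0 ≤ v c) → ∀ i, wt R Y v (σ i) ≤
      v (e i) + ∑ j, if j < i then v (e j) else 0 := by
    intro v hv i
    rw [hwt, ← Finset.sum_ite_eq' Finset.univ i (fun j => v (e j)) |>.trans
      (if_pos (Finset.mem_univ i)), ← Finset.sum_add_distrib]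
    refine Finset.sum_le_sum fun j _ => ?_
    rcases lt_trichotomy j i with h | h | h
    · have := hv (e j)
      split_ifs <;> linarith
    · have := hv (e j)
      split_ifs <;> linarith
    · rw [if_neg (ht i j h)]
      have := hv (e j)
      split_ifs <;> linarith
  have hle : ∀ (v : Y → ℝ), (∀ c, 0 ≤ v c) → ∀ i, v (e i) ≤ wt R Y v (σ i) := by
    intro v hv i
    rw [hwt]
    refine le_trans (le_of_eq (if_pos (hd i)).symm) (Finset.single_le_sum
      (f := fun j => if (fun a => σ i (y j a)) ∈ R then v (e j) else 0) (fun j _ => ?_)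
      (Finset.mem_univ i))
    have := hv (e j)
    split_ifs <;> linarith
  have hup : ∀ i, wt R Y w (σ i) ≤ 2 * B ^ (i : ℕ) := by
    intro i
    refine (hsplit w (fun c => (hpos c).le) i).trans ?_
    simp only [hwe]
    have h1 := hgeom i
    have h2 : B ^ (i : ℕ) / (B - 1) ≤ B ^ (i : ℕ) := div_le_self (by positivity) (by linarith)
    linarith
  obtain ⟨w', ⟨hw'0, hw'⟩, hcard⟩ := (sparsity_isLeast R Y w (fun c => (hpos c).le) ε hε.le).1
  have hne : ∀ i, w' (e i) ≠ 0 := by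
    intro i hi
    have h4 : ∀ j, w' (e j) ≤ 4 * B ^ (j : ℕ) := fun j => by
      have h1 := hle w' hw'0 j
      have h2 := (hw' (σ j)).2
      have h3 := hup j
      have h5 := wt_nonneg R Y w (fun c => (hpos c).le) (σ j)
      nlinarith
    have h1 := (hw' (σ i)).1
    have h2 := hle w (fun c => (hpos c).le) i
    rw [hwe] at h2
    have h3 := hsplit w' hw'0 i
    rw [hi, zero_add] at h3
    have h5 : (∑ j, if j < i then w' (e j) else 0) ≤
        4 * ∑ j : Fin q, if j < i then B ^ (j : ℕ) else 0 := by
      rw [Finset.mul_sum]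
      refine Finset.sum_le_sum fun j _ => ?_
      split_ifs
      · exact h4 j
      · simp
    have h6 := hgeom i
    have h7 : (1 - ε) * B ^ (i : ℕ) ≤ 4 * (B ^ (i : ℕ) / (B - 1)) := by
      nlinarith [mul_le_mul_of_nonneg_left h2 hε'.le]
    have hBi : 0 < B ^ (i : ℕ) := by positivity
    rw [← mul_div_assoc, le_div_iff₀ (by linarith)] at h7
    nlinarith
  have hsup : Function.support w' = Set.univ := by
    ext c
    simpa using e.apply_symm_apply c ▸ hne (e.symm c)
  have hq : q = sparsity R Y w ε := by
    rw [← hcard, hsup, Set.ncard_univ, ← Nat.card_congr e, Nat.card_fin]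
  exact (wSPR_isGreatest R n ε hε.le).2 ⟨Y, w, hpos, hq.symm⟩

/-- For each inclusion choose an assignment gained and a clause of the smaller instance's system
that it violates in the complement, so satisfies in `R`. For `j > i` the assignment `σ i` still lies
in the solution set of `Ψ j`, hence fails clause `j` in `R`. -/
theorem chainLength_le_wSPR_add_one {D : Type*} {r n : ℕ} (R : Set (Fin r → D)) {ε : ℝ}
    (hε : 0 < ε) (hε1 : ε < 1) : chainLength Rᶜ n ≤ wSPR R n ε + 1 := by
  obtain ⟨Ψ, hΨ⟩ := (chainLength_isGreatest Rᶜ n).1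
  generalize chainLength Rᶜ n = ℓ at Ψ
  rcases ℓ with _ | q
  · lia
  have hex : ∀ i : Fin q, ∃ (y : Fin r → Fin n) (σ : Fin n → D), y ∈ Ψ i.castSucc ∧
      (fun a => σ (y a)) ∈ R ∧ σ ∈ sat Rᶜ (Ψ i.succ) := by
    intro i
    obtain ⟨σ, h1, h2⟩ := Set.exists_of_ssubset (hΨ (Fin.castSucc_lt_succ (i := i)))
    simp only [sat, Set.mem_ofPred_eq, not_forall] at h2
    obtain ⟨y, hy, h⟩ := h2
    exact ⟨y, σ, hy, not_not.1 h, h1⟩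
  choose y σ hy hd hs using hex
  refine Nat.succ_le_succ (le_wSPR_of_triangular R hε hε1 y σ hd fun i j hij => ?_)
  have : i.succ ≤ j.castSucc := by
    rw [Fin.le_def]
    simpa using hij
  exact hΨ.monotone this (hs i) (y j) (hy j)

/-! ### The upper bound -/

open Classical in
/-- The sets of clauses satisfied by the assignments. -/
noncomputable def satisfiedSets {D X : Type*} {r : ℕ} (R : Set (Fin r → D))
    (Y : CSPInstance X r) : Finset (Finset Y) :=
  Finset.univ.filter fun S => ∃ σ : X → D, S = Finset.univ.filter fun y =>
    (fun i => σ (y.1 i)) ∈ R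

-- The suffixes of a triangular list, from the whole list to the empty one, are one more than its
-- length. Dropping `y` from the front enlarges the solution set for the complement: the assignment
-- behind the set at `y` satisfies `y` in `R` and none of the later clauses.
open Classical in
theorem rank_satisfiedSets_lt_chainLength {D : Type*} {r n : ℕ} (R : Set (Fin r → D))
    (Y : CSPInstance (Fin n) r) :
    SetFamily.rank (satisfiedSets R Y) < chainLength Rᶜ n := by
  obtain ⟨l, hl, hlen⟩ := SetFamily.exists_triangular (satisfiedSets R Y)
  have hdrop : ∀ i, SetFamily.Triangular (satisfiedSets R Y) (l.drop i) := by
    intro i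
    induction i with
    | zero => exact hl
    | succ i ih =>
      rw [← List.tail_drop]
      cases h : l.drop i with
      | nil => trivial
      | cons a t => exact (h ▸ ih).2
  refine (chainLength_isGreatest Rᶜ n).2
    ⟨fun i => ((l.drop i).map Subtype.val).toFinset, Fin.strictMono_iff_lt_succ.2 fun i => ?_⟩
  have hi : (i : ℕ) < l.length := i.2.trans_eq hlen.symm
  have hcons := List.drop_eq_getElem_cons hi
  have hT := hdrop i
  rw [hcons] at hT
  obtain ⟨⟨S, hS, hy, hz⟩, -⟩ := hT
  obtain ⟨σ, rfl⟩ := (Finset.mem_filter.1 hS).2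
  refine Set.ssubset_iff_exists.2 ⟨fun τ hτ c hc => hτ c ?_, σ, fun c hc => ?_, fun h => ?_⟩
  · simp only [Fin.val_castSucc, hcons]
    simp only [Fin.val_succ] at hc
    simp only [List.mem_toFinset, List.map_cons, List.mem_cons] at hc ⊢
    exact Or.inr hc
  · simp only [Fin.val_succ, List.mem_toFinset, List.mem_map] at hc
    obtain ⟨d, hd, rfl⟩ := hc
    have := hz d hd
    simpa using this
  · refine h l[(i : ℕ)].1 ?_ (by simpa using hy)
    simp only [Fin.val_castSucc, hcons, List.map_cons, List.mem_toFinset, List.mem_cons, true_or]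

open Classical in
theorem wt_eq_sum_filter {D X : Type*} {r : ℕ} (R : Set (Fin r → D)) (Y : CSPInstance X r)
    (w : Y → ℝ) (σ : X → D) :
    wt R Y w σ = ∑ y ∈ Finset.univ.filter fun y : Y => (fun i => σ (y.1 i)) ∈ R, w y := by
  rw [wt, Finset.sum_filter]
  simp only [mul_ite, mul_one, mul_zero]

/-! ### Choice of parameters -/

open Classical in
theorem sparsity_le_of_parameters {D : Type*} {r n : ℕ} (R : Set (Fin r → D))
    (Y : CSPInstance (Fin n) r) (w : Y → ℝ) (hw : ∀ y, 0 < w y) {ε : ℝ} (hε : 0 < ε)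
    {δ A b : ℝ} (hn : 1 ≤ n ^ r) (hδ : 0 < δ) (hδ1 : δ ≤ 1) (hA : 1 ≤ A) (hb : 0 ≤ b)
    (hq : (((n ^ r : ℕ) : ℝ) + 1) * Real.exp (-(b / 2)) ≤ 1 / 8)
    (hAb : b + 2 * (harmonic (n ^ r) : ℝ) ≤ δ ^ 2 / 4 * A)
    (hδε : δ * (4 + Real.logb 2 (3 * (n ^ r : ℕ) / δ)) ≤ ε) :
    (sparsity R Y w ε : ℝ) ≤ 7 * A * chainLength Rᶜ n := by
  have hcard : Fintype.card Y ≤ n ^ r := by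
    rw [Fintype.card_coe]
    exact (Finset.card_le_univ _).trans (by simp)
  obtain ⟨w', h0, hsize, herr⟩ := SetFamily.exists_sparsifier hw hcard hn hδ hδ1 hA hb hq hAb
    (satisfiedSets R Y)
  have hsp : IsSparsifier R Y w ε w' := by
    refine ⟨h0, fun σ => ?_⟩
    have h1 := herr _ (Finset.mem_filter.2 ⟨Finset.mem_univ _, σ, rfl⟩)
    rw [← wt_eq_sum_filter, ← wt_eq_sum_filter] at h1
    have h2 := mul_le_mul_of_nonneg_right hδε (wt_nonneg R Y w (fun y => (hw y).le) σ)
    have h3 := abs_le.1 (h1.trans h2)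
    constructor <;> linarith [h3.1, h3.2]
  have h1 : sparsity R Y w ε ≤ (Finset.univ.filter (w' · ≠ 0)).card := by
    refine (sparsity_isLeast R Y w (fun y => (hw y).le) ε hε.le).2 ⟨w', hsp, ?_⟩
    rw [← Set.ncard_coe_finset]
    congr 1
    ext
    simp
  have h2 : (SetFamily.rank (satisfiedSets R Y) : ℝ) ≤ chainLength Rᶜ n := by
    exact_mod_cast (rank_satisfiedSets_lt_chainLength R Y).le
  calc (sparsity R Y w ε : ℝ) ≤ (Finset.univ.filter (w' · ≠ 0)).card := by exact_mod_cast h1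
    _ ≤ _ := hsize
    _ ≤ _ := mul_le_mul_of_nonneg_left h2 (by linarith)

theorem sparsity_le {D : Type*} {r n : ℕ} (R : Set (Fin r → D)) (Y : CSPInstance (Fin n) r)
    (w : Y → ℝ) (hw : ∀ y, 0 < w y) {ε : ℝ} (hε : 0 < ε) (hε1 : ε < 1) (hr : 1 ≤ r)
    (hn : 2 ≤ n) :
    (sparsity R Y w ε : ℝ) ≤
      100352 * (chainLength Rᶜ n * Real.logb 2 (n ^ r : ℕ) ^ 3 / ε ^ 2) := by
  set N : ℝ := ((n ^ r : ℕ) : ℝ) with hN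
  set t := Real.logb 2 N with ht
  have hN2' : 2 ≤ n ^ r := hn.trans (Nat.le_self_pow (by lia) n)
  have hN2 : 2 ≤ N := by
    rw [hN]
    exact_mod_cast hN2'
  have hN0 : 0 < N := by linarith
  have ht1 : 1 ≤ t := by
    rw [ht, Real.le_logb_iff_rpow_le one_lt_two hN0, Real.rpow_one]
    exact hN2
  have hlog : Real.log N = t * Real.log 2 := by
    rw [ht, Real.logb, div_mul_cancel₀ _ (Real.log_pos one_lt_two).ne']
  have hlog2 : Real.log 2 ≤ 1 := by linarith [Real.log_two_lt_d9]
  have hlog20 : 0 < Real.log 2 := Real.log_pos one_lt_two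
  have hCL : (1 : ℝ) ≤ chainLength Rᶜ n := by
    exact_mod_cast (Nat.zero_le _).trans_lt (rank_satisfiedSets_lt_chainLength R Y)
  have ht3 : 1 ≤ t ^ 3 := one_le_pow₀ ht1
  -- For `N ≤ 1 / ε ^ 2` keeping all clauses suffices. Otherwise `1 / ε ≤ N`, so `log (3 * N / δ)`
  -- is of order `log N`.
  rcases le_total N (1 / ε ^ 2) with hsmall | hlarge
  · have h1 : (sparsity R Y w ε : ℝ) ≤ N := by
      have h2 := (sparsity_isLeast R Y w (fun y => (hw y).le) ε hε.le).2
        ⟨w, isSparsifier_self R Y w (fun y => (hw y).le) ε hε.le, rfl⟩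
      have h3 : (Function.support w).ncard ≤ n ^ r := by
        refine (Set.ncard_le_card _).trans ?_
        rw [Nat.card_eq_fintype_card, Fintype.card_coe]
        exact (Finset.card_le_univ _).trans (by simp)
      rw [hN]
      exact_mod_cast h2.trans h3
    refine h1.trans (hsmall.trans ?_)
    rw [← mul_div_assoc]
    refine div_le_div_of_nonneg_right ?_ (by positivity)
    nlinarith [one_le_mul_of_one_le_of_one_le hCL ht3]
  -- `δ` absorbs the number of levels, since `4 + (6 + 3 * t) ≤ 16 * t`; `b` and `A` make `hq` and
  -- `hAb` equalities.
  · set δ := ε / (16 * t) with hδ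
    set b := 2 * Real.log (8 * (N + 1)) with hb
    set A := 4 / δ ^ 2 * (b + 2 * (harmonic (n ^ r) : ℝ)) with hA
    have hδ0 : 0 < δ := by positivity
    have hδ1 : δ ≤ 1 := by
      rw [hδ, div_le_one (by positivity)]
      linarith
    have hb1 : 1 ≤ b := by
      have h1 : Real.log 2 ≤ Real.log (8 * (N + 1)) :=
        Real.log_le_log (by norm_num) (by linarith)
      linarith [Real.log_two_gt_d9]
    have hb10 : b ≤ 10 * t := by
      have h1 : Real.log (8 * (N + 1)) ≤ Real.log (2 ^ 4 * N) :=
        Real.log_le_log (by positivity) (by linarith)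
      rw [Real.log_mul (by norm_num) hN0.ne', Real.log_pow, hlog] at h1
      push_cast at h1
      nlinarith
    have hH0 : (0 : ℝ) ≤ harmonic (n ^ r) := by
      exact_mod_cast (harmonic_pos (by lia)).le
    have hH : (harmonic (n ^ r) : ℝ) ≤ 2 * t := by
      have h1 := harmonic_le_one_add_log (n ^ r)
      rw [← hN, hlog] at h1
      nlinarith
    have hA1 : 1 ≤ A := by
      refine one_le_mul_of_one_le_of_one_le ?_ (by linarith)
      rw [one_le_div (by positivity)]
      nlinarith
    have hAle : A ≤ 14336 * (t ^ 3 / ε ^ 2) := by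
      have h1 : b + 2 * (harmonic (n ^ r) : ℝ) ≤ 14 * t := by linarith
      calc A ≤ 4 / δ ^ 2 * (14 * t) := mul_le_mul_of_nonneg_left h1 (by positivity)
        _ = _ := by
          rw [hδ]
          field_simp
          norm_num
    have hq : (N + 1) * Real.exp (-(b / 2)) ≤ 1 / 8 := by
      rw [hb, mul_div_cancel_left₀ _ two_ne_zero, Real.exp_neg, Real.exp_log (by positivity)]
      refine le_of_eq ?_
      field_simp
    have hAb : b + 2 * (harmonic (n ^ r) : ℝ) ≤ δ ^ 2 / 4 * A := by
      refine le_of_eq ?_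
      rw [hA]
      field_simp
    have hδε : δ * (4 + Real.logb 2 (3 * N / δ)) ≤ ε := by
      have hεN : 1 / ε ≤ N := by
        refine le_trans ?_ hlarge
        rw [div_le_div_iff₀ hε (by positivity)]
        nlinarith
      have htN : t ≤ N := by
        have h1 : t * Real.log 2 ≤ N * Real.log 2 := by
          rw [← hlog, ← Real.log_rpow two_pos]
          refine Real.log_le_log hN0 ?_
          rw [hN, Real.rpow_natCast]
          exact_mod_cast Nat.lt_two_pow_self.le
        exact le_of_mul_le_mul_right h1 hlog20
      have h1 : 3 * N / δ ≤ 2 ^ 6 * N ^ 3 := by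
        have h2 : 3 * N / δ = 48 * N * (t * (1 / ε)) := by
          rw [hδ]
          field_simp
          norm_num
        have h3 : t * (1 / ε) ≤ N * N := mul_le_mul htN hεN (by positivity) hN0.le
        rw [h2]
        have h4 := mul_le_mul_of_nonneg_left h3 hN0.le
        have h5 : 0 < N ^ 3 := by positivity
        nlinarith
      have h2 : Real.logb 2 (3 * N / δ) ≤ 6 + 3 * t := by
        refine (Real.logb_le_logb_of_le one_lt_two (by positivity) h1).trans (le_of_eq ?_)
        rw [Real.logb_mul (by norm_num) (by positivity), Real.logb_pow, Real.logb_pow,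
          Real.logb_self_eq_one one_lt_two]
        push_cast
        ring
      calc δ * (4 + Real.logb 2 (3 * N / δ)) ≤ δ * (16 * t) :=
            mul_le_mul_of_nonneg_left (by linarith) hδ0.le
        _ = ε := by rw [hδ, div_mul_cancel₀ _ (by positivity)]
    refine (sparsity_le_of_parameters R Y w hw hε (by lia) hδ0 hδ1 hA1 (by linarith) hq hAb
      hδε).trans ?_
    have := mul_le_mul_of_nonneg_right hAle (by linarith : (0 : ℝ) ≤ chainLength Rᶜ n)
    calc 7 * A * chainLength Rᶜ n = 7 * (A * chainLength Rᶜ n) := by ring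
      _ ≤ 7 * (14336 * (t ^ 3 / ε ^ 2) * chainLength Rᶜ n) := by linarith
      _ = _ := by ring

theorem wSPR_le {D : Type*} {r n : ℕ} (R : Set (Fin r → D)) {ε : ℝ} (hε : 0 < ε) (hε1 : ε < 1)
    (hr : 1 ≤ r) (hn : 2 ≤ n) :
    (wSPR R n ε : ℝ) ≤
      6422528 * (chainLength Rᶜ n * (r * Real.log n) ^ 6 / ε ^ 2) := by
  obtain ⟨Y, w, hw, h⟩ := (wSPR_isGreatest R n ε hε.le).1
  rw [← h]
  refine (sparsity_le R Y w hw hε hε1 hr hn).trans ?_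
  set t := Real.logb 2 (n ^ r : ℕ) with ht
  have hlog : r * Real.log n = t * Real.log 2 := by
    rw [ht, Real.logb, div_mul_cancel₀ _ (Real.log_pos one_lt_two).ne', Nat.cast_pow,
      Real.log_pow]
  have ht1 : 1 ≤ t := by
    have hN2 : 2 ≤ n ^ r := hn.trans (Nat.le_self_pow (by lia) n)
    rw [ht, Real.le_logb_iff_rpow_le one_lt_two (by positivity), Real.rpow_one]
    exact_mod_cast hN2
  -- The exponent is relaxed here because `t ≥ 1`. The factor `64 = 2 ^ 6` in the next step comes
  -- from `log 2 ≥ 1 / 2`.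
  have h1 : t ^ 3 ≤ t ^ 6 := pow_le_pow_right₀ ht1 (by norm_num)
  have h2 : t ^ 6 ≤ 64 * (r * Real.log n) ^ 6 := by
    have h3 : (t / 2) ^ 6 ≤ (r * Real.log n) ^ 6 := by
      refine pow_le_pow_left₀ (by linarith) ?_ 6
      rw [hlog]
      nlinarith [Real.log_two_gt_d9]
    calc t ^ 6 = 64 * (t / 2) ^ 6 := by ring
      _ ≤ _ := by linarith
  have h4 := mul_le_mul_of_nonneg_left (h1.trans h2)
    (by positivity : (0 : ℝ) ≤ chainLength Rᶜ n / ε ^ 2)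
  calc _ = 100352 * (chainLength Rᶜ n / ε ^ 2 * t ^ 3) := by ring
    _ ≤ 100352 * (chainLength Rᶜ n / ε ^ 2 * (64 * (r * Real.log n) ^ 6)) := by linarith
    _ = _ := by ring

end WeightedCSP

theorem mainTheorem7 :
    ∃ C : ℝ, 0 < C ∧
      ∀ (D : Type*) [Finite D] (r : ℕ) (R : Set (Fin r → D)) (n : ℕ) (ε : ℝ),
        1 ≤ r → 1 ≤ n → 0 < ε → ε < 1 →
        (WeightedCSP.chainLength Rᶜ n : ℝ) - 1 ≤ (WeightedCSP.wSPR R n ε : ℝ) ∧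
        (2 ≤ n →
          (WeightedCSP.wSPR R n ε : ℝ) ≤
            C * ((WeightedCSP.chainLength Rᶜ n : ℝ) * ((r : ℝ) * Real.log (n : ℝ)) ^ 6 / ε ^ 2)) := by
  refine ⟨6422528, by norm_num, fun D _ r R n ε hr _ hε hε1 => ⟨?_, fun hn => ?_⟩⟩
  · rw [sub_le_iff_le_add]
    exact_mod_cast WeightedCSP.chainLength_le_wSPR_add_one R hε hε1
  · exact WeightedCSP.wSPR_le R hε hε1 hr hn
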